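/- Let $X$ be a compact metric space and let $\xi=(\xi(x))_{x\in X}$ be a real Gaussian process with continuous sample paths on a probability space $(\Omega,\mathcal F,P)$ (with arbitrary mean and covariance functions). The process is observed without noise: $Z_n=\xi(X_n)$ at design points $X_1,X_2,\dots$ forming a sequential design, i.e. $X_{n+1}$ is measurable with respect to $\mathcal F_n=\sigma(X_1,Z_1,\dots,X_n,Z_n)$ for every $n\ge 0$. Let $P_n$ denote the conditional distribution of $\xi$ given $\mathcal F_n$, a random Gaussian measure on $C(X)$, with mean function $m_n$ and standard deviation function $\sigma_n$. For a Gaussian measure $\nu$ on $C(X)$ with mean function $m_\nu$ and standard deviation function $\sigma_\nu$, put $$\mathcal H(\nu)=\int \max f\;\nu(df)-\max_{u:\,\sigma_\nu(u)=0} m_\nu(u)\in[0,+\infty],$$ where a maximum over the empty set is $-\infty$, and, for $x\in X$, $$\mathcal J_x(\nu)=\int \mathcal H\bigl(\mathrm{Cond}_{x,f(x)}(\nu)\bigr)\,\nu(df),$$ where $\mathrm{Cond}_{x,z}(\nu)$ is the conditional distribution of $f\sim\nu$ given $f(x)=z$. Assume that the design is quasi-SUR for $\mathcal H$: there are positive numbers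 $\varepsilon_n\to0$ and an integer $n_0$ such that, for all $n\ge n_0$, almost surely, $$\mathcal J_{X_{n+1}}(P_n)\le\inf_{x\in X}\mathcal J_x(P_n)+\varepsilon_n .$$ Let $H_n=\mathcal H(P_n)$ and $M_n=\max_{u:\,\sigma_n(u)=0}\xi(u)$; for each $n\ge1$ the set $\{\sigma_n=0\}$ is almost surely non-empty, so that $M_n$ and $H_n$ are finite. Then, as $n\to\infty$, almost surely and in $L^1$, $$\max_{x\in X} m_n(x)-M_n\to0,\qquad H_n\to0,\qquad M_n\to\max_{x\in X}\xi(x).$$ No further condition on the covariance function (such as the no-empty-ball property) is assumed. -/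

import Mathlib

open MeasureTheory ProbabilityTheory Filter Topology
open scoped ENNReal

noncomputable section

namespace ExpectedImprovement

/-- The space `C(X, ℝ)` of continuous functions carries its Borel `σ`-algebra. -/
instance instMeasurableSpaceContinuousMap {X : Type*} [TopologicalSpace X] :
    MeasurableSpace C(X, ℝ) := borel C(X, ℝ)

instance instBorelSpaceContinuousMap {X : Type*} [TopologicalSpace X] :
    BorelSpace C(X, ℝ) := ⟨rfl⟩

section Functionals

variable {X : Type*} [MetricSpace X] [CompactSpace X]

/-- The maximum of a continuous function over the (non-empty) compact space `X`. -/
def pathMax (f : C(X, ℝ)) : ℝ := ⨆ x, f x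

/-- The mean function of a probability measure on `C(X, ℝ)`. -/
def meanFn (ν : Measure C(X, ℝ)) (x : X) : ℝ := ∫ f, f x ∂ν

/-- The covariance function of a probability measure on `C(X, ℝ)`. -/
def covFn (ν : Measure C(X, ℝ)) (x y : X) : ℝ :=
  cov[fun f : C(X, ℝ) => f x, fun f : C(X, ℝ) => f y; ν]

/-- The standard deviation function `σ(x) = k(x, x) ^ (1/2)`. -/
def sdFn (ν : Measure C(X, ℝ)) (x : X) : ℝ := √(covFn ν x x)

/-- The set `{u | σ(u) = 0}` of the points at which the value of the process is known. -/
def zeroSet (ν : Measure C(X, ℝ)) : Set X := {u | sdFn ν u = 0}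

/-- The expected improvement functional `H(ν) = E(max ξ) - max_{σ(u) = 0} m(u)`, with the
convention that a maximum over the empty set is `-∞` (so that `H(ν) = +∞` if `σ` has no zero). -/
def functionalH (ν : Measure C(X, ℝ)) : EReal :=
  ((∫ f, pathMax f ∂ν : ℝ) : EReal) - ⨆ u ∈ zeroSet ν, (meanFn ν u : EReal)

/-- `Cond_{x, z}(ν)`: the conditional distribution, under `ν`, of the function `f` given
`f x = z` (one noiseless observation at `x`). It is determined for almost every `z` with respect
to the law of `f x` under `ν`. -/
def cond (ν : Measure C(X, ℝ)) [IsFiniteMeasure ν] (x : X) (z : ℝ) : Measure C(X, ℝ) :=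
  condDistrib (fun f : C(X, ℝ) => f) (fun f : C(X, ℝ) => f x) ν z

/-- The functional `J_x(ν) = ∫ H(Cond_{x, f(x)}(ν)) ν(df)`: the expected residual uncertainty
after one more noiseless observation, at `x`. It does not depend on the version of the
conditional distribution. Here `H ≥ 0`, see `functionalH_nonneg`. -/
def functionalJ (ν : Measure C(X, ℝ)) [IsFiniteMeasure ν] (x : X) : ℝ≥0∞ :=
  ∫⁻ f, (functionalH (cond ν x (f x))).toENNReal ∂ν

end Functionals

section Design

variable {X : Type*} [MetricSpace X] [CompactSpace X] [MeasurableSpace X]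
variable {Ω : Type*} [MeasurableSpace Ω]

/-- The first `n` design points and noiseless observations, `(X_1, Z_1, …, X_n, Z_n)` with
`Z_i = ξ(X_i)`. The design is indexed from `0`: `D i` is `X_{i+1}`. -/
def obs (ξ : Ω → C(X, ℝ)) (D : ℕ → Ω → X) (n : ℕ) (ω : Ω) : Fin n → X × ℝ :=
  fun i => (D i ω, ξ ω (D i ω))

/-- The `σ`-algebra `F_n` generated by `X_1, Z_1, …, X_n, Z_n`. -/
abbrev obsSigma (ξ : Ω → C(X, ℝ)) (D : ℕ → Ω → X) (n : ℕ) : MeasurableSpace Ω :=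
  MeasurableSpace.comap (obs ξ D n) inferInstance

/-- `D` is a sequential design: `X_{n+1}` is `F_n`-measurable for all `n ≥ 0`. -/
def IsSequentialDesign (ξ : Ω → C(X, ℝ)) (D : ℕ → Ω → X) : Prop :=
  ∀ n, Measurable[obsSigma ξ D n] (D n)

/-- The conditional distribution `P_n` of `ξ` given `F_n`, as a random measure on `C(X, ℝ)`.
It is almost surely a Gaussian measure when `ξ` is Gaussian. -/
def post (P : Measure Ω) [IsFiniteMeasure P] (ξ : Ω → C(X, ℝ)) (D : ℕ → Ω → X) (n : ℕ) (ω : Ω) :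
    Measure C(X, ℝ) :=
  condDistrib ξ (obs ξ D n) P (obs ξ D n ω)

instance instIsProbabilityMeasurePost (P : Measure Ω) [IsFiniteMeasure P] (ξ : Ω → C(X, ℝ))
    (D : ℕ → Ω → X) (n : ℕ) (ω : Ω) : IsProbabilityMeasure (post P ξ D n ω) := by
  unfold post; infer_instance

/-- `D` is a quasi-SUR sequential design associated with `H`: it is a sequential design and, for
some positive `ε_n → 0` and some `n₀`, `J_n(X_{n+1}) ≤ inf J_n + ε_n` almost surely for all
`n ≥ n₀`, where `J_n(x) = J_x(P_n)`. -/
def IsQuasiSUR (P : Measure Ω) [IsFiniteMeasure P] (ξ : Ω → C(X, ℝ)) (D : ℕ → Ω → X) : Prop :=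
  IsSequentialDesign ξ D ∧
    ∃ ε : ℕ → ℝ, (∀ n, 0 < ε n) ∧ Tendsto ε atTop (𝓝 0) ∧
      ∃ n₀ : ℕ, ∀ n ≥ n₀, ∀ᵐ ω ∂P,
        functionalJ (post P ξ D n ω) (D n ω) ≤
          (⨅ x, functionalJ (post P ξ D n ω) x) + ENNReal.ofReal (ε n)

/-- `H_n = H(P_n)`. -/
def residual (P : Measure Ω) [IsFiniteMeasure P] (ξ : Ω → C(X, ℝ)) (D : ℕ → Ω → X) (n : ℕ)
    (ω : Ω) : EReal :=
  functionalH (post P ξ D n ω)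

/-- `max m_n`, the maximum over `X` of the conditional mean function. -/
def maxMean (P : Measure Ω) [IsFiniteMeasure P] (ξ : Ω → C(X, ℝ)) (D : ℕ → Ω → X) (n : ℕ)
    (ω : Ω) : ℝ :=
  ⨆ x, meanFn (post P ξ D n ω) x

/-- `M_n = max_{σ_n(u) = 0} ξ(u)`. -/
def knownMax (P : Measure Ω) [IsFiniteMeasure P] (ξ : Ω → C(X, ℝ)) (D : ℕ → Ω → X) (n : ℕ)
    (ω : Ω) : ℝ :=
  ⨆ u : zeroSet (post P ξ D n ω), ξ ω u

/-- Convergence in `L¹` of a sequence `Y_1, Y_2, …` of real random variables. -/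
def TendstoInL1 (P : Measure Ω) (Y : ℕ → Ω → ℝ) (Y' : Ω → ℝ) : Prop :=
  (∀ n ≥ 1, Integrable (Y n) P) ∧ Integrable Y' P ∧
    Tendsto (fun n => ∫ ω, |Y n ω - Y' ω| ∂P) atTop (𝓝 0)

end Design

section Nonneg

variable {X : Type*} [MetricSpace X] [CompactSpace X]

lemma le_pathMax (f : C(X, ℝ)) (x : X) : f x ≤ pathMax f :=
  le_ciSup (isCompact_range f.continuous).bddAbove x

lemma abs_pathMax_le [Nonempty X] (f : C(X, ℝ)) : |pathMax f| ≤ ‖f‖ := by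
  obtain ⟨x₀⟩ := ‹Nonempty X›
  rw [abs_le]
  refine ⟨?_, ciSup_le fun x => (abs_le.1 (f.norm_coe_le_norm x)).2⟩
  exact (abs_le.1 (f.norm_coe_le_norm x₀)).1.trans (le_pathMax f x₀)

lemma continuous_pathMax [Nonempty X] : Continuous (pathMax : C(X, ℝ) → ℝ) := by
  have key : ∀ f g : C(X, ℝ), pathMax f ≤ pathMax g + 1 * dist f g := fun f g =>
    ciSup_le fun x => by
      have h1 := (f - g).norm_coe_le_norm x
      rw [← dist_eq_norm, ContinuousMap.sub_apply] at h1
      have h2 := (abs_le.1 h1).2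
      have h3 := le_pathMax g x
      linarith
  exact (LipschitzWith.of_le_add_mul 1 key).continuous

/-- `0 ≤ H(ν)` for every Gaussian measure `ν` on `C(X, ℝ)`. -/
lemma functionalH_nonneg [Nonempty X] (ν : Measure C(X, ℝ)) [IsGaussian ν] :
    0 ≤ functionalH ν := by
  have hid : Integrable (fun f : C(X, ℝ) => f) ν := IsGaussian.integrable_id
  have hmax : Integrable (pathMax : C(X, ℝ) → ℝ) ν :=
    hid.norm.mono' continuous_pathMax.aestronglyMeasurable (ae_of_all _ abs_pathMax_le)
  have hev : ∀ u : X, Integrable (fun f : C(X, ℝ) => f u) ν := fun u =>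
    hid.norm.mono' (continuous_eval_const u).aestronglyMeasurable
      (ae_of_all _ fun f => f.norm_coe_le_norm u)
  have hle : (⨆ u ∈ zeroSet ν, (meanFn ν u : EReal)) ≤ ((∫ f, pathMax f ∂ν : ℝ) : EReal) :=
    iSup₂_le fun u _ => EReal.coe_le_coe_iff.2
      (integral_mono (hev u) hmax fun f => le_pathMax f u)
  exact (EReal.sub_nonneg (Or.inl (EReal.coe_ne_top _)) (Or.inl (EReal.coe_ne_bot _))).2 hle

end Nonneg

end ExpectedImprovement

end

/-!
Write `M_n` for the known maximum after `n` observations and `M = max ξ`. Everything follows from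
a comparison of expectations.

The expected residual uncertainty after an observation is `E M - E M'`, where `M'` is the known
maximum after that observation (`lintegral_functionalH`). This applies to the observation made by
the design and also to an observation at a fixed point `x` instead, for which
`M' ≥ max(M_n, ξ(x))`. In both cases the expectation of `J` at the observed point is the expected
residual uncertainty (`lintegral_functionalJ`), because conditioning `P_n` on one more value gives
the conditional distribution with respect to the enlarged observation (`cond_condDistrib_ae_eq`).
The quasi-SUR inequality therefore yields `E max(M_n, ξ(x)) ≤ E M_{n+1} + ε_n`
(`integral_max_le_add`).

The sequence `M_n` is almost surely non-decreasing and bounded by `M`; let `L` be its limit. In the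
limit, `E max(L, ξ(x)) ≤ E L`, so that `ξ(x) ≤ L` almost surely, for each `x`. By continuity of the
paths, `L = M` (`ae_tendsto_knownMax`). By Lévy's upward theorem the conditional expectations
`E_n M` converge to the conditional expectation of `M` given all the observations, which dominates
`L = M` and has the same expectation; hence `E_n M → M` (`ae_tendsto_integral_pathMax`), and
`H_n = E_n M - M_n → 0`. Finally `0 ≤ max m_n - M_n ≤ H_n`. Convergence in `L¹` follows from
`E H_n = E M - E M_n → 0`.

Gaussianity enters only through the square-integrability of `‖ξ‖` (`integrable_norm_sq`). The
random set `{σ_n = 0}` is handled by means of a penalization (`forall_zero_le_iff_penalized`),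
which turns statements about all its points into countably many inequalities.
-/

namespace ExpectedImprovement

/-! ### Square-integrability of the supremum norm -/

section Gaussian

variable {X : Type*} [MetricSpace X] [CompactSpace X] {Ω : Type*} [MeasurableSpace Ω]

lemma measurableEmbedding_eval_denseSeq [Nonempty X] :
    MeasurableEmbedding fun (f : C(X, ℝ)) (n : ℕ) => f (TopologicalSpace.denseSeq X n) := by
  refine Continuous.measurableEmbedding (continuous_pi fun n => continuous_eval_const _) ?_
  intro f g hfg
  have h : (f : X → ℝ) = g :=
    (TopologicalSpace.denseRange_denseSeq X).equalizer f.continuous g.continuous hfg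
  exact DFunLike.coe_injective h

/-- The Borel `σ`-algebra of `C(X, ℝ)` is generated by the evaluations, by the Lusin-Souslin
theorem. -/
lemma measurable_of_measurable_eval [Nonempty X] {ξ : Ω → C(X, ℝ)}
    (h : ∀ x, Measurable fun ω => ξ ω x) : Measurable ξ :=
  measurableEmbedding_eval_denseSeq.measurable_comp_iff.1 (measurable_pi_lambda _ fun _ => h _)

/-- A continuous function is approximated, by means of a partition of unity of mesh `δ`, by a
fixed finite-rank operator that only uses its values at finitely many points. -/
lemma exists_partition_approx {δ : ℝ} (hδ : 0 < δ) :
    ∃ (s : Finset X) (φ : s → C(X, ℝ)), ∀ (f : C(X, ℝ)) (η : ℝ), 0 ≤ η →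
      (∀ x y, dist x y < δ → dist (f x) (f y) ≤ η) → ‖∑ i : s, f i • φ i - f‖ ≤ η := by
  obtain ⟨t, -, htf, ht⟩ := (isCompact_univ (X := X)).finite_cover_balls hδ
  have hcov : (Set.univ : Set X) ⊆ ⋃ i : htf.toFinset, Metric.ball (i : X) δ := by
    intro x hx
    obtain ⟨y, hy, hxy⟩ := Set.mem_iUnion₂.1 (ht hx)
    exact Set.mem_iUnion.2 ⟨⟨y, htf.mem_toFinset.2 hy⟩, hxy⟩
  obtain ⟨p, hp⟩ := PartitionOfUnity.exists_isSubordinate isClosed_univ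
    (fun i : htf.toFinset => Metric.ball (i : X) δ) (fun _ => Metric.isOpen_ball) hcov
  refine ⟨htf.toFinset, fun i => p i, fun f η hη hf => ?_⟩
  refine (ContinuousMap.norm_le _ hη).2 fun x => ?_
  have hsum : ∑ i, p i x = 1 := by
    rw [← finsum_eq_sum_of_fintype]; exact p.sum_eq_one (Set.mem_univ x)
  have hdiff : (∑ i : htf.toFinset, f i • p i - f) x = ∑ i : htf.toFinset, (f i - f x) * p i x := by
    simp only [ContinuousMap.sub_apply, ContinuousMap.sum_apply, ContinuousMap.smul_apply,
      smul_eq_mul, sub_mul, Finset.sum_sub_distrib]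
    rw [← Finset.mul_sum, hsum, mul_one]
  rw [hdiff]
  calc ‖∑ i : htf.toFinset, (f i - f x) * p i x‖
      ≤ ∑ i : htf.toFinset, ‖(f i - f x) * p i x‖ := norm_sum_le _ _
    _ ≤ ∑ i, η * p i x := by
        refine Finset.sum_le_sum fun i _ => ?_
        have h0 : 0 ≤ p i x := p.nonneg i x
        rw [norm_mul, Real.norm_of_nonneg h0]
        by_cases h : p i x = 0
        · simp [h]
        · have hx : x ∈ Metric.ball (i : X) δ := hp i (subset_closure h)
          refine mul_le_mul_of_nonneg_right ?_ h0
          rw [← dist_eq_norm]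
          exact hf _ _ (by rw [dist_comm]; exact hx)
    _ = η := by rw [← Finset.mul_sum, hsum, mul_one]

/-- Every continuous linear functional on `C(X, ℝ)` is a pointwise limit of finite linear
combinations of evaluations. -/
lemma exists_tendsto_sum_eval (L : StrongDual ℝ C(X, ℝ)) :
    ∃ (s : ℕ → Finset X) (c : ∀ k, s k → ℝ), ∀ f : C(X, ℝ),
      Tendsto (fun k => ∑ i : s k, c k i * f i) atTop (𝓝 (L f)) := by
  choose s φ hφ using fun k : ℕ =>
    exists_partition_approx (X := X) (δ := 1 / ((k : ℝ) + 1)) (by positivity)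
  refine ⟨s, fun k i => L (φ k i), fun f => ?_⟩
  have hconv : Tendsto (fun k => ∑ i : s k, f i • φ k i) atTop (𝓝 f) := by
    rw [Metric.tendsto_atTop]
    intro η hη
    have hu := CompactSpace.uniformContinuous_of_continuous f.continuous
    obtain ⟨δ, hδ, hf⟩ := Metric.uniformContinuous_iff.1 hu (η / 2) (by positivity)
    obtain ⟨N, hN⟩ := exists_nat_one_div_lt hδ
    refine ⟨N, fun k hk => ?_⟩
    rw [dist_eq_norm]
    refine (hφ k f (η / 2) (by positivity) fun x y hxy => (hf ?_).le).trans_lt (by linarith)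
    exact hxy.trans_le ((Nat.one_div_le_one_div hk).trans hN.le)
  have := (L.continuous.tendsto f).comp hconv
  refine this.congr fun k => ?_
  simp [map_sum, mul_comm]

/-- The modulus of the characteristic function of a pointwise limit of Gaussian variables is that
of a Gaussian variable. -/
lemma exists_norm_charFun_sq_eq {P : Measure Ω} [IsProbabilityMeasure P] {Y : ℕ → Ω → ℝ}
    {Z : Ω → ℝ} (hY : ∀ k, HasGaussianLaw (Y k) P)
    (hZ : ∀ ω, Tendsto (fun k => Y k ω) atTop (𝓝 (Z ω))) :
    ∃ v : NNReal, ∀ t : ℝ, ‖charFun (P.map Z) t‖ ^ 2 = Real.exp (-(v * t ^ 2)) := by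
  have hZm : AEMeasurable Z P :=
    aemeasurable_of_tendsto_metrizable_ae atTop (fun k => (hY k).aemeasurable) (ae_of_all _ hZ)
  have hprob : IsProbabilityMeasure (P.map Z) := Measure.isProbabilityMeasure_map hZm
  -- the modulus removes the means, so that only the variances `v k` have to converge
  set v : ℕ → ℝ := fun k => ((Var[Y k; P]).toNNReal : ℝ) with hv
  have hchar : ∀ k (t : ℝ), ‖charFun (P.map (Y k)) t‖ ^ 2 = Real.exp (-(v k * t ^ 2)) := by
    intro k t
    rw [(hY k).map_eq_gaussianReal, charFun_gaussianReal, Complex.norm_exp, ← Real.exp_nat_mul]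
    congr 1
    have : (((t : ℂ) * ((∫ ω, Y k ω ∂P : ℝ) : ℂ) * Complex.I
        - (((Var[Y k; P]).toNNReal : ℝ) : ℂ) * (t : ℂ) ^ 2 / 2)).re = - (v k * t ^ 2) / 2 := by
      simp only [Complex.sub_re, hv]
      rw [← Complex.ofReal_mul, Complex.re_ofReal_mul, Complex.I_re, ← Complex.ofReal_pow,
        ← Complex.ofReal_mul]
      have h2 : ((((Var[Y k; P]).toNNReal : ℝ) * t ^ 2 : ℝ) : ℂ) / 2
        = (((((Var[Y k; P]).toNNReal : ℝ) * t ^ 2) / 2 : ℝ) : ℂ) := by push_cast; ring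
      rw [h2, Complex.ofReal_re]
      ring
    rw [this]; push_cast; ring
  have hlim : ∀ t : ℝ, Tendsto (fun k => Real.exp (-(v k * t ^ 2))) atTop
      (𝓝 (‖charFun (P.map Z) t‖ ^ 2)) := by
    intro t
    simp_rw [← hchar]
    refine ((Tendsto.norm ?_).pow 2)
    have hcf : ∀ W : Ω → ℝ, AEMeasurable W P →
        charFun (P.map W) t = ∫ ω, Complex.exp (t * W ω * Complex.I) ∂P := by
      intro W hW
      rw [charFun_apply_real, integral_map hW (by fun_prop)]
    rw [hcf Z hZm]
    simp_rw [fun k => hcf (Y k) (hY k).aemeasurable]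
    refine tendsto_integral_of_dominated_convergence (fun _ => 1) (fun k => ?_)
      (integrable_const _) (fun k => ae_of_all _ fun ω => ?_) (ae_of_all _ fun ω => ?_)
    · have := (hY k).aemeasurable
      exact (by fun_prop : AEMeasurable (fun ω => Complex.exp (t * Y k ω * Complex.I))
        P).aestronglyMeasurable
    · rw [← Complex.ofReal_mul, Complex.norm_exp_ofReal_mul_I]
    · have hc : Continuous fun y : ℝ => Complex.exp (t * y * Complex.I) := by fun_prop
      exact (hc.tendsto _).comp (hZ ω)
  -- the limit does not vanish near `0`, which forces the variances to converge
  obtain ⟨t₀, ht₀, hpos⟩ : ∃ t₀ : ℝ, t₀ ≠ 0 ∧ 0 < ‖charFun (P.map Z) t₀‖ ^ 2 := by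
    have hcont : Continuous fun t : ℝ => ‖charFun (P.map Z) t‖ ^ 2 := by
      have : Continuous (charFun (P.map Z)) := continuous_charFun
      fun_prop
    have h0 : (0 : ℝ) < ‖charFun (P.map Z) 0‖ ^ 2 := by simp
    have hev : ∀ᶠ t in 𝓝[≠] (0 : ℝ), 0 < ‖charFun (P.map Z) t‖ ^ 2 :=
      nhdsWithin_le_nhds (hcont.tendsto 0 |>.eventually (lt_mem_nhds h0))
    obtain ⟨t, ht, htne⟩ := (hev.and self_mem_nhdsWithin).exists
    exact ⟨t, htne, ht⟩
  have hvlim : Tendsto v atTop (𝓝 (-Real.log (‖charFun (P.map Z) t₀‖ ^ 2) / t₀ ^ 2)) := by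
    have := (((hlim t₀).log hpos.ne').neg).div_const (t₀ ^ 2)
    refine this.congr fun k => ?_
    rw [Real.log_exp, neg_neg]
    field_simp
  have hv0 : 0 ≤ -Real.log (‖charFun (P.map Z) t₀‖ ^ 2) / t₀ ^ 2 :=
    ge_of_tendsto' hvlim fun k => NNReal.coe_nonneg _
  refine ⟨⟨_, hv0⟩, fun t => tendsto_nhds_unique (hlim t) ?_⟩
  exact (Real.continuous_exp.tendsto _).comp (hvlim.mul_const (t ^ 2)).neg

/-- The symmetrization of the law of a continuous Gaussian process is a Gaussian measure. -/
lemma isGaussian_conv_neg {P : Measure Ω} [IsProbabilityMeasure P] {ξ : Ω → C(X, ℝ)}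
    (hm : Measurable ξ) (hξ : IsGaussianProcess (fun (x : X) (ω : Ω) => ξ ω x) P) :
    IsGaussian (P.map ξ ∗ (P.map ξ).map (ContinuousLinearEquiv.neg ℝ (M := C(X, ℝ)))) := by
  have : IsProbabilityMeasure (P.map ξ) := Measure.isProbabilityMeasure_map hm.aemeasurable
  have : IsProbabilityMeasure ((P.map ξ).map (ContinuousLinearEquiv.neg ℝ (M := C(X, ℝ)))) :=
    Measure.isProbabilityMeasure_map (by fun_prop)
  refine isGaussian_of_map_eq_gaussianReal fun L => ?_
  obtain ⟨s, c, hL⟩ := exists_tendsto_sum_eval L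
  obtain ⟨v, hv⟩ := exists_norm_charFun_sq_eq (P := P) (Y := fun k ω => ∑ i : s k, c k i * ξ ω i)
    (Z := fun ω => L (ξ ω)) (fun k => by
      have h := (hξ.hasGaussianLaw (s k)).map
        (∑ i, c k i • ContinuousLinearMap.proj (R := ℝ) (φ := fun _ : s k => ℝ) i)
      refine h.congr (ae_of_all _ fun ω => ?_)
      simp) (fun ω => hL (ξ ω))
  refine ⟨0, 2 * v, Measure.ext_of_charFun ?_⟩
  funext t
  have h1 : charFunDual (P.map ξ) (t • L) = charFun (P.map fun ω => L (ξ ω)) t := by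
    rw [← charFun_map_eq_charFunDual_smul, Measure.map_map (by fun_prop) hm]; rfl
  have h2 : charFunDual ((P.map ξ).map (ContinuousLinearEquiv.neg ℝ (M := C(X, ℝ)))) (t • L)
      = (starRingEnd ℂ) (charFun (P.map fun ω => L (ξ ω)) t) := by
    rw [← charFun_neg, ← charFun_map_eq_charFunDual_smul,
      Measure.map_map (by fun_prop) (by fun_prop),
      Measure.map_map (by fun_prop) hm, charFun_apply_real, charFun_apply_real,
      integral_map (by fun_prop) (by fun_prop), integral_map (by fun_prop) (by fun_prop)]
    simp
  rw [charFun_map_eq_charFunDual_smul, charFunDual_conv, h1, h2, Complex.mul_conj,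
    Complex.normSq_eq_norm_sq, hv, charFun_gaussianReal]
  push_cast
  congr 1
  ring

/-- A Gaussian process with continuous paths on a compact space has a square-integrable supremum
norm: Fernique's theorem applies to its symmetrization. -/
lemma integrable_norm_sq {P : Measure Ω} [IsProbabilityMeasure P] {ξ : Ω → C(X, ℝ)}
    (hm : Measurable ξ) (hξ : IsGaussianProcess (fun (x : X) (ω : Ω) => ξ ω x) P) :
    Integrable (fun ω => ‖ξ ω‖ ^ 2) P := by
  have : IsProbabilityMeasure (P.map ξ) := Measure.isProbabilityMeasure_map hm.aemeasurable
  have hG := isGaussian_conv_neg hm hξ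
  set ν := (P.map ξ).map (ContinuousLinearEquiv.neg ℝ (M := C(X, ℝ))) with hν
  have hνp : IsProbabilityMeasure ν := Measure.isProbabilityMeasure_map (by fun_prop)
  have h2 : Integrable (fun f => ‖f‖ ^ 2) (P.map ξ ∗ ν) :=
    (IsGaussian.memLp_id (P.map ξ ∗ ν) 2 (by simp)).integrable_norm_pow (by simp)
  rw [integrable_conv_iff (by fun_prop)] at h2
  -- by Fubini, the symmetrized variable may be replaced by the shift of `ξ` by a fixed path `g`
  obtain ⟨g, hg⟩ := h2.1.exists
  rw [hν, integrable_map_measure (by fun_prop) (by fun_prop),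
    integrable_map_measure (by fun_prop) hm.aemeasurable] at hg
  have hg' : Integrable (fun ω => 2 * ‖g - ξ ω‖ ^ 2 + 2 * ‖g‖ ^ 2) P := by
    refine (Integrable.const_mul ?_ 2).add (integrable_const _)
    simpa [Function.comp_def, sub_eq_add_neg] using hg
  refine hg'.mono' (by fun_prop) (ae_of_all _ fun ω => ?_)
  rw [Real.norm_of_nonneg (by positivity)]
  have h3 : ‖ξ ω‖ ≤ ‖g - ξ ω‖ + ‖g‖ := by
    have := norm_sub_le g (g - ξ ω)
    rw [sub_sub_cancel] at this
    linarith
  have h4 := pow_le_pow_left₀ (norm_nonneg _) h3 2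
  nlinarith [sq_nonneg (‖g - ξ ω‖ - ‖g‖)]

end Gaussian

/-! ### Mean and standard deviation functions of square-integrable measures -/

section SquareIntegrable

variable {X : Type*} [MetricSpace X] {ν : Measure C(X, ℝ)}

lemma covFn_self (x : X) : covFn ν x x = ∫ f, (f x - meanFn ν x) ^ 2 ∂ν := by
  simp only [covFn, covariance, meanFn, sq]

variable [CompactSpace X]

lemma integrable_norm_of_sq [IsProbabilityMeasure ν]
    (hν : Integrable (fun f : C(X, ℝ) => ‖f‖ ^ 2) ν) :
    Integrable (fun f : C(X, ℝ) => ‖f‖) ν :=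
  ((memLp_two_iff_integrable_sq (by fun_prop)).2 hν).integrable (by norm_num)

lemma integrable_eval (hν : Integrable (fun f : C(X, ℝ) => ‖f‖) ν) (x : X) :
    Integrable (fun f : C(X, ℝ) => f x) ν :=
  hν.mono' (continuous_eval_const x).aestronglyMeasurable
    (ae_of_all _ fun f => f.norm_coe_le_norm x)

lemma integrable_pathMax [Nonempty X] (hν : Integrable (fun f : C(X, ℝ) => ‖f‖) ν) :
    Integrable (pathMax : C(X, ℝ) → ℝ) ν :=
  hν.mono' continuous_pathMax.aestronglyMeasurable (ae_of_all _ abs_pathMax_le)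

lemma abs_meanFn_le (hν : Integrable (fun f : C(X, ℝ) => ‖f‖) ν) (x : X) :
    |meanFn ν x| ≤ ∫ f, ‖f‖ ∂ν :=
  norm_integral_le_of_norm_le hν (ae_of_all _ fun f => f.norm_coe_le_norm x)

lemma meanFn_le_integral_pathMax [Nonempty X] (hν : Integrable (fun f : C(X, ℝ) => ‖f‖) ν)
    (x : X) : meanFn ν x ≤ ∫ f, pathMax f ∂ν :=
  integral_mono (integrable_eval hν x) (integrable_pathMax hν) fun f => le_pathMax f x

lemma continuous_meanFn (hν : Integrable (fun f : C(X, ℝ) => ‖f‖) ν) :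
    Continuous (meanFn ν) :=
  continuous_of_dominated (fun x => (continuous_eval_const x).aestronglyMeasurable)
    (fun x => ae_of_all _ fun f => f.norm_coe_le_norm x) hν
    (ae_of_all _ fun f => f.continuous)

lemma sq_sub_meanFn_le [IsProbabilityMeasure ν]
    (hν : Integrable (fun f : C(X, ℝ) => ‖f‖ ^ 2) ν) (x : X) (f : C(X, ℝ)) :
    (f x - meanFn ν x) ^ 2 ≤ 2 * ‖f‖ ^ 2 + 2 * (∫ g, ‖g‖ ∂ν) ^ 2 := by
  have h1 := pow_le_pow_left₀ (abs_nonneg _) (f.norm_coe_le_norm x) 2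
  have h2 := pow_le_pow_left₀ (abs_nonneg _) (abs_meanFn_le (integrable_norm_of_sq hν) x) 2
  rw [Real.norm_eq_abs, sq_abs] at h1
  rw [sq_abs] at h2
  nlinarith [sq_nonneg (f x + meanFn ν x)]

lemma continuous_sdFn [IsProbabilityMeasure ν]
    (hν : Integrable (fun f : C(X, ℝ) => ‖f‖ ^ 2) ν) :
    Continuous (sdFn ν) := by
  unfold sdFn
  refine Real.continuous_sqrt.comp ?_
  simp_rw [covFn_self]
  refine continuous_of_dominated (bound := fun f => 2 * ‖f‖ ^ 2 + 2 * (∫ g, ‖g‖ ∂ν) ^ 2)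
    (fun x => ?_) (fun x => ae_of_all _ fun f => ?_)
    ((hν.const_mul 2).add (integrable_const _)) (ae_of_all _ fun f => ?_)
  · have := continuous_eval_const (F := C(X, ℝ)) x
    exact (by fun_prop : Continuous fun f : C(X, ℝ) => (f x - meanFn ν x) ^ 2).aestronglyMeasurable
  · rw [Real.norm_of_nonneg (sq_nonneg _)]
    exact sq_sub_meanFn_le hν x f
  · have := continuous_meanFn (integrable_norm_of_sq hν)
    fun_prop

lemma mem_zeroSet_iff [IsProbabilityMeasure ν]
    (hν : Integrable (fun f : C(X, ℝ) => ‖f‖ ^ 2) ν) (x : X) :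
    x ∈ zeroSet ν ↔ ∀ᵐ f ∂ν, f x = meanFn ν x := by
  have hint : Integrable (fun f : C(X, ℝ) => (f x - meanFn ν x) ^ 2) ν := by
    refine ((hν.const_mul 2).add (integrable_const _)).mono' ?_
      (ae_of_all _ fun f => (Real.norm_of_nonneg (sq_nonneg _)).trans_le (sq_sub_meanFn_le hν x f))
    have := continuous_eval_const (F := C(X, ℝ)) x
    exact (by fun_prop : Continuous fun f : C(X, ℝ) => (f x - meanFn ν x) ^ 2).aestronglyMeasurable
  have h0 : 0 ≤ ∫ f, (f x - meanFn ν x) ^ 2 ∂ν := integral_nonneg fun f => sq_nonneg _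
  rw [zeroSet, Set.mem_ofPred_eq, sdFn, covFn_self, Real.sqrt_eq_zero h0,
    integral_eq_zero_iff_of_nonneg (fun f => sq_nonneg _) hint]
  refine eventually_congr (ae_of_all _ fun f => ?_)
  simp [sub_eq_zero]

lemma mem_zeroSet_of_ae_eq_const [IsProbabilityMeasure ν]
    (hν : Integrable (fun f : C(X, ℝ) => ‖f‖ ^ 2) ν) {x : X} {z : ℝ}
    (h : ∀ᵐ f ∂ν, f x = z) : x ∈ zeroSet ν := by
  have : meanFn ν x = z := by
    rw [meanFn, integral_congr_ae h]; simp
  rw [mem_zeroSet_iff hν, this]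
  exact h

/-- Almost every path agrees with the mean function on the whole of the zero set: it suffices to
look at a countable dense subset. -/
lemma ae_eq_meanFn_on_zeroSet [IsProbabilityMeasure ν]
    (hν : Integrable (fun f : C(X, ℝ) => ‖f‖ ^ 2) ν) :
    ∀ᵐ f ∂ν, ∀ u ∈ zeroSet ν, f u = meanFn ν u := by
  obtain ⟨t, htc, htd⟩ := TopologicalSpace.exists_countable_dense (zeroSet ν)
  have h : ∀ᵐ f ∂ν, ∀ u ∈ t, f u = meanFn ν u :=
    (ae_ball_iff htc).2 fun u _ => (mem_zeroSet_iff hν u).1 u.2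
  filter_upwards [h] with f hf u hu
  have hcm := continuous_meanFn (integrable_norm_of_sq hν)
  have heq : (fun u : zeroSet ν => f u) = fun u : zeroSet ν => meanFn ν u :=
    Continuous.ext_on htd (by fun_prop) (by fun_prop) hf
  exact congrFun heq ⟨u, hu⟩

end SquareIntegrable

/-! ### Continuous functions on a compact space -/

section Penalization

variable {X : Type*} [MetricSpace X] [CompactSpace X] [Nonempty X]

/-- An inequality on the zero set of a continuous function `s ≥ 0` on a compact space amounts to
countably many inequalities, by penalization. -/
lemma forall_zero_le_iff_penalized {h s : X → ℝ} (hh : Continuous h) (hs : Continuous s)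
    (hs0 : ∀ x, 0 ≤ s x) :
    (∀ u, s u = 0 → h u ≤ 0) ↔
      ∀ j : ℕ, ∃ k : ℕ, ∀ i : ℕ, h (TopologicalSpace.denseSeq X i) ≤
        1 / ((j : ℝ) + 1) + k * s (TopologicalSpace.denseSeq X i) := by
  constructor
  · intro H j
    have hj : (0 : ℝ) < 1 / ((j : ℝ) + 1) := by positivity
    set K : Set X := {x | 1 / ((j : ℝ) + 1) ≤ h x} with hK
    have hKc : IsCompact K := (isClosed_le continuous_const hh).isCompact
    obtain ⟨C, hC⟩ := (isCompact_univ.bddAbove_image hh.continuousOn)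
    have hC' : ∀ x, h x ≤ C := fun x => hC (Set.mem_image_of_mem _ (Set.mem_univ x))
    rcases K.eq_empty_or_nonempty with hKe | hKn
    · refine ⟨0, fun i => ?_⟩
      have : TopologicalSpace.denseSeq X i ∉ K := by rw [hKe]; exact Set.notMem_empty _
      simp only [hK, Set.mem_ofPred_eq, not_le] at this
      simpa using this.le
    · obtain ⟨x₀, hx₀, hmin⟩ := hKc.exists_isMinOn hKn hs.continuousOn
      -- `s` is bounded below on the set where `h` is large, so a large penalty `k` compensates `h`
      have hpos : 0 < s x₀ := by
        refine lt_of_le_of_ne (hs0 x₀) fun h0 => ?_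
        have h1 := H x₀ h0.symm
        have h2 : 1 / ((j : ℝ) + 1) ≤ h x₀ := hx₀
        linarith
      obtain ⟨k, hk⟩ := exists_nat_ge (C / s x₀)
      refine ⟨k, fun i => ?_⟩
      set x := TopologicalSpace.denseSeq X i
      have hks : 0 ≤ (k : ℝ) * s x := mul_nonneg (Nat.cast_nonneg k) (hs0 x)
      by_cases hx : x ∈ K
      · have h1 : s x₀ ≤ s x := hmin hx
        have h2 : C ≤ k * s x₀ := (div_le_iff₀ hpos).1 hk
        have h3 : (k : ℝ) * s x₀ ≤ k * s x := mul_le_mul_of_nonneg_left h1 (Nat.cast_nonneg k)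
        linarith [hC' x]
      · simp only [hK, Set.mem_ofPred_eq, not_le] at hx
        linarith
  · intro H u hu
    refine le_of_forall_pos_le_add fun ε hε => ?_
    obtain ⟨j, hj⟩ := exists_nat_one_div_lt hε
    obtain ⟨k, hk⟩ := H j
    have hall : ∀ x, h x ≤ 1 / ((j : ℝ) + 1) + k * s x := by
      have hcl : IsClosed {x | h x ≤ 1 / ((j : ℝ) + 1) + k * s x} :=
        isClosed_le hh (by fun_prop)
      intro x
      have : closure (Set.range (TopologicalSpace.denseSeq X))
          ⊆ {x | h x ≤ 1 / ((j : ℝ) + 1) + k * s x} :=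
        closure_minimal (Set.range_subset_iff.2 hk) hcl
      exact this ((TopologicalSpace.denseRange_denseSeq X) x)
    have := hall u
    rw [hu] at this
    linarith

/-- The maximum of a continuous function over a compact space is that over a dense sequence. -/
lemma iSup_eq_iSup_denseSeq {h : X → ℝ} (hh : Continuous h) :
    ⨆ x, h x = ⨆ i, h (TopologicalSpace.denseSeq X i) := by
  have hb : BddAbove (Set.range h) := (isCompact_range hh).bddAbove
  have hb' : BddAbove (Set.range fun i => h (TopologicalSpace.denseSeq X i)) :=
    hb.mono (by rintro _ ⟨i, rfl⟩; exact ⟨_, rfl⟩)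
  refine le_antisymm (ciSup_le fun x => ?_) (ciSup_le fun i => le_ciSup hb _)
  have hcl : IsClosed {x | h x ≤ ⨆ i, h (TopologicalSpace.denseSeq X i)} :=
    isClosed_le hh continuous_const
  exact closure_minimal (Set.range_subset_iff.2 fun i => le_ciSup hb' i) hcl
    ((TopologicalSpace.denseRange_denseSeq X) x)

end Penalization

/-! ### Measurability in a kernel -/

section Kernels

variable {X : Type*} [MetricSpace X]
variable {A : Type*} [MeasurableSpace A] (κ : Kernel A C(X, ℝ)) 

lemma measurable_meanFn (x : X) : Measurable fun y => meanFn (κ y) x :=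
  (StronglyMeasurable.integral_kernel (κ := κ)
    (continuous_eval_const (F := C(X, ℝ)) x).stronglyMeasurable).measurable

variable [IsMarkovKernel κ]

lemma measurable_sdFn (x : X) : Measurable fun y => sdFn (κ y) x := by
  unfold sdFn
  refine Real.continuous_sqrt.measurable.comp ?_
  simp_rw [covFn_self]
  have h : StronglyMeasurable (Function.uncurry fun (y : A) (f : C(X, ℝ)) =>
      (f x - meanFn (κ y) x) ^ 2) := by
    refine Measurable.stronglyMeasurable ?_
    have h1 := (continuous_eval_const (F := C(X, ℝ)) x).measurable.comp
      (measurable_snd : Measurable (Prod.snd : A × C(X, ℝ) → C(X, ℝ)))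
    have h2 := (measurable_meanFn κ x).comp
      (measurable_fst : Measurable (Prod.fst : A × C(X, ℝ) → A))
    exact (h1.sub h2).pow_const 2
  exact h.integral_kernel_prod_right.measurable

end Kernels

/-! ### The functional `H` -/

section KnownPoints

variable {X : Type*} [MetricSpace X] [CompactSpace X]
variable {ν : Measure C(X, ℝ)} [IsProbabilityMeasure ν]

/-- For a square-integrable measure whose standard deviation has a zero, `H` is a real number. -/
lemma functionalH_eq_coe (hν : Integrable (fun f : C(X, ℝ) => ‖f‖ ^ 2) ν)
    (hne : (zeroSet ν).Nonempty) :
    functionalH ν = ((∫ f, pathMax f ∂ν - ⨆ u : zeroSet ν, meanFn ν u : ℝ) : EReal) := by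
  have hcm := continuous_meanFn (integrable_norm_of_sq hν)
  have hZ : IsCompact (zeroSet ν) :=
    (isClosed_eq (continuous_sdFn hν) continuous_const).isCompact
  obtain ⟨u₀, hu₀, hmax⟩ := hZ.exists_isMaxOn hne hcm.continuousOn
  have hne' : Nonempty (zeroSet ν) := hne.to_subtype
  have h1 : ⨆ u : zeroSet ν, meanFn ν u = meanFn ν u₀ :=
    le_antisymm (ciSup_le fun u => hmax u.2)
      (le_ciSup (f := fun u : zeroSet ν => meanFn ν u)
        ⟨meanFn ν u₀, by rintro _ ⟨u, rfl⟩; exact hmax u.2⟩ ⟨u₀, hu₀⟩)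
  have h2 : ⨆ u ∈ zeroSet ν, (meanFn ν u : EReal) = (meanFn ν u₀ : EReal) :=
    le_antisymm (iSup₂_le fun u hu => EReal.coe_le_coe_iff.2 (hmax hu))
      (le_iSup₂ (f := fun u (_ : u ∈ zeroSet ν) => (meanFn ν u : EReal)) u₀ hu₀)
  rw [functionalH, h1, h2, EReal.coe_sub]

lemma bddAbove_range_restrict {g : X → ℝ} (hg : Continuous g) (Z : Set X) :
    BddAbove (Set.range fun u : Z => g u) :=
  (isCompact_range hg).bddAbove.mono (by rintro _ ⟨u, rfl⟩; exact ⟨u, rfl⟩)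

end KnownPoints

/-! ### Conditional distributions given an observation -/

section Observation

variable {X : Type*} [MetricSpace X] [CompactSpace X]
variable {Ω : Type*} [MeasurableSpace Ω] {P : Measure Ω} [IsProbabilityMeasure P]
variable {ξ : Ω → C(X, ℝ)} {A A' : Type*} [MeasurableSpace A] [MeasurableSpace A']
variable {Y : Ω → A} {Y' : Ω → A'}

/-- An event of full probability for `(Y, ξ)` has full probability under the conditional
distribution of `ξ` given `Y`. -/
lemma ae_ae_condDistrib (hm : Measurable ξ) {p : A × C(X, ℝ) → Prop}
    (h : ∀ᵐ z ∂P.map (fun ω => (Y ω, ξ ω)), p z) :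
    ∀ᵐ y ∂P.map Y, ∀ᵐ f ∂condDistrib ξ Y P y, p (y, f) := by
  rw [← compProd_map_condDistrib hm.aemeasurable] at h
  exact Measure.ae_ae_of_ae_compProd h

lemma ae_integrable_norm_sq (hm : Measurable ξ) (hY : Measurable Y)
    (hsq : Integrable (fun ω => ‖ξ ω‖ ^ 2) P) :
    ∀ᵐ y ∂P.map Y, Integrable (fun f : C(X, ℝ) => ‖f‖ ^ 2) (condDistrib ξ Y P y) := by
  refine Integrable.condDistrib_ae_map (f := fun z : A × C(X, ℝ) => ‖z.2‖ ^ 2) hm.aemeasurable ?_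
  have hc : Measurable fun z : A × C(X, ℝ) => ‖z.2‖ ^ 2 := by fun_prop
  exact (integrable_map_measure hc.aestronglyMeasurable (by fun_prop)).2 hsq

/-- Almost surely, the path agrees with the conditional mean at all the points where the
conditional standard deviation vanishes. -/
lemma ae_map_eq_meanFn_on_zeroSet [Nonempty X] (hm : Measurable ξ) (hY : Measurable Y)
    (hsq : Integrable (fun ω => ‖ξ ω‖ ^ 2) P) :
    ∀ᵐ z ∂P.map (fun ω => (Y ω, ξ ω)), ∀ u ∈ zeroSet (condDistrib ξ Y P z.1),
      z.2 u = meanFn (condDistrib ξ Y P z.1) u := by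
  set κ := condDistrib ξ Y P with hκ
  have hnice := ae_integrable_norm_sq hm hY hsq
  -- a measurable reformulation of the event
  set p : A × C(X, ℝ) → Prop := fun z => ∀ j : ℕ, ∃ k : ℕ, ∀ i : ℕ,
    |z.2 (TopologicalSpace.denseSeq X i) - meanFn (κ z.1) (TopologicalSpace.denseSeq X i)| ≤
      1 / ((j : ℝ) + 1) + k * sdFn (κ z.1) (TopologicalSpace.denseSeq X i) with hp
  have hpm : MeasurableSet {z | p z} := by
    simp only [hp, Set.ofPred_forall, Set.ofPred_exists]
    refine MeasurableSet.iInter fun j => MeasurableSet.iUnion fun k =>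
      MeasurableSet.iInter fun i => ?_
    have h1 : Measurable fun z : A × C(X, ℝ) => z.2 (TopologicalSpace.denseSeq X i) :=
      (continuous_eval_const (F := C(X, ℝ)) _).measurable.comp measurable_snd
    have h2 : Measurable fun z : A × C(X, ℝ) => meanFn (κ z.1) (TopologicalSpace.denseSeq X i) :=
      (measurable_meanFn κ _).comp measurable_fst
    have h3 : Measurable fun z : A × C(X, ℝ) => sdFn (κ z.1) (TopologicalSpace.denseSeq X i) :=
      (measurable_sdFn κ _).comp measurable_fst
    exact measurableSet_le (by fun_prop) (by fun_prop)
  have hiff : ∀ z : A × C(X, ℝ), Integrable (fun f : C(X, ℝ) => ‖f‖ ^ 2) (κ z.1) →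
      (p z ↔ ∀ u ∈ zeroSet (κ z.1), z.2 u = meanFn (κ z.1) u) := by
    intro z hz
    have hcm := continuous_meanFn (integrable_norm_of_sq hz)
    refine (forall_zero_le_iff_penalized (h := fun x => |z.2 x - meanFn (κ z.1) x|)
      (by fun_prop) (continuous_sdFn hz) (fun x => Real.sqrt_nonneg _)).symm.trans ?_
    refine forall_congr' fun u => imp_congr Iff.rfl ?_
    rw [abs_nonpos_iff, sub_eq_zero]
  have hall : ∀ᵐ z ∂P.map (fun ω => (Y ω, ξ ω)), p z := by
    rw [← compProd_map_condDistrib hm.aemeasurable, Measure.ae_compProd_iff hpm]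
    filter_upwards [hnice] with y hy
    filter_upwards [ae_eq_meanFn_on_zeroSet hy] with f hf
    exact (hiff (y, f) hy).2 hf
  have hfst : ∀ᵐ z ∂P.map (fun ω => (Y ω, ξ ω)),
      Integrable (fun f : C(X, ℝ) => ‖f‖ ^ 2) (κ z.1) := by
    have : P.map Y = (P.map fun ω => (Y ω, ξ ω)).map Prod.fst := by
      rw [Measure.map_map measurable_fst (hY.prodMk hm)]; rfl
    rw [this] at hnice
    exact ae_of_ae_map measurable_fst.aemeasurable hnice
  filter_upwards [hall, hfst] with z hz1 hz2
  exact (hiff z hz2).1 hz1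

/-- A point that is known from the observation `Y = h(Y')` is known from the observation `Y'`. -/
lemma ae_zeroSet_subset [Nonempty X] (hm : Measurable ξ) (hY' : Measurable Y')
    (hsq : Integrable (fun ω => ‖ξ ω‖ ^ 2) P) {h : A' → A} (hh : Measurable h)
    (hYY' : ∀ ω, Y ω = h (Y' ω)) :
    ∀ᵐ ω ∂P, zeroSet (condDistrib ξ Y P (Y ω)) ⊆ zeroSet (condDistrib ξ Y' P (Y' ω)) := by
  have hY : Measurable Y := (funext hYY' : Y = fun ω => h (Y' ω)) ▸ hh.comp hY'
  have h1 := ae_map_eq_meanFn_on_zeroSet hm hY hsq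
  have hmap : P.map (fun ω => (Y ω, ξ ω))
      = (P.map fun ω => (Y' ω, ξ ω)).map (Prod.map h id) := by
    rw [Measure.map_map (hh.prodMap measurable_id) (hY'.prodMk hm)]
    congr 1
    funext ω
    simp [hYY']
  rw [hmap] at h1
  have h2 := ae_ae_condDistrib hm (ae_of_ae_map (hh.prodMap measurable_id).aemeasurable h1)
  filter_upwards [ae_of_ae_map hY'.aemeasurable h2,
    ae_of_ae_map hY'.aemeasurable (ae_integrable_norm_sq hm hY' hsq)] with ω hω hsqω u hu
  rw [hYY' ω] at hu
  refine mem_zeroSet_of_ae_eq_const (z := meanFn (condDistrib ξ Y P (h (Y' ω))) u) hsqω ?_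
  exact hω.mono fun f hf => hf u hu

/-- A point at which the process has been observed is known. -/
lemma ae_mem_zeroSet [MeasurableSpace X] [BorelSpace X] (hm : Measurable ξ)
    (hY : Measurable Y) (hsq : Integrable (fun ω => ‖ξ ω‖ ^ 2) P) {h : A → X × ℝ}
    (hh : Measurable h) (hval : ∀ ω, ξ ω (h (Y ω)).1 = (h (Y ω)).2) :
    ∀ᵐ y ∂P.map Y, (h y).1 ∈ zeroSet (condDistrib ξ Y P y) := by
  have hev : Measurable fun z : A × C(X, ℝ) => z.2 (h z.1).1 := by
    have hc : Measurable fun q : C(X, ℝ) × X => q.1 q.2 := continuous_eval.measurable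
    exact hc.comp (measurable_snd.prodMk (hh.comp measurable_fst).fst)
  have h1 : ∀ᵐ z ∂P.map (fun ω => (Y ω, ξ ω)), z.2 (h z.1).1 = (h z.1).2 := by
    have hset : MeasurableSet {z : A × C(X, ℝ) | z.2 (h z.1).1 = (h z.1).2} :=
      measurableSet_eq_fun hev (hh.comp measurable_fst).snd
    exact (ae_map_iff (hY.prodMk hm).aemeasurable hset).2 (ae_of_all _ hval)
  filter_upwards [ae_ae_condDistrib hm h1, ae_integrable_norm_sq hm hY hsq] with y hy hsqy
  exact mem_zeroSet_of_ae_eq_const hsqy hy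

/-- The best value that is known from the observation `Y`: the maximum of the path over the points
at which the conditional standard deviation given `Y` vanishes. -/
noncomputable def obsMax (P : Measure Ω) [IsFiniteMeasure P] (ξ : Ω → C(X, ℝ)) (Y : Ω → A)
    (ω : Ω) : ℝ :=
  ⨆ u : zeroSet (condDistrib ξ Y P (Y ω)), ξ ω u

lemma aemeasurable_iSup_meanFn [Nonempty X] (hm : Measurable ξ) (hY : Measurable Y)
    (hsq : Integrable (fun ω => ‖ξ ω‖ ^ 2) P)
    (hne : ∀ᵐ y ∂P.map Y, (zeroSet (condDistrib ξ Y P y)).Nonempty) :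
    AEMeasurable (fun y => ⨆ u : zeroSet (condDistrib ξ Y P y), meanFn (condDistrib ξ Y P y) u)
      (P.map Y) := by
  set κ := condDistrib ξ Y P with hκ
  set μ := P.map Y
  have key : @Measurable (NullMeasurableSpace A μ) ℝ _ _
      (fun y => ⨆ u : zeroSet (κ y), meanFn (κ y) u) := by
    refine measurable_of_Iic fun a => ?_
    have hmeas : MeasurableSet {y | ∀ j : ℕ, ∃ k : ℕ, ∀ i : ℕ,
        meanFn (κ y) (TopologicalSpace.denseSeq X i) - a ≤
          1 / ((j : ℝ) + 1) + k * sdFn (κ y) (TopologicalSpace.denseSeq X i)} := by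
      simp only [Set.ofPred_forall, Set.ofPred_exists]
      refine MeasurableSet.iInter fun j => MeasurableSet.iUnion fun k =>
        MeasurableSet.iInter fun i => ?_
      have h2 := measurable_meanFn κ (TopologicalSpace.denseSeq X i)
      have h3 := measurable_sdFn κ (TopologicalSpace.denseSeq X i)
      exact measurableSet_le (by fun_prop) (by fun_prop)
    refine NullMeasurableSet.congr (μ := μ) hmeas.nullMeasurableSet ?_
    filter_upwards [ae_integrable_norm_sq hm hY hsq, hne] with y hy hney
    have hcm := continuous_meanFn (integrable_norm_of_sq hy)
    have hne' : Nonempty (zeroSet (κ y)) := hney.to_subtype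
    refine propext ((forall_zero_le_iff_penalized (h := fun x => meanFn (κ y) x - a)
      (by fun_prop) (continuous_sdFn hy) (fun x => Real.sqrt_nonneg _)).symm.trans ?_)
    refine Iff.trans ?_ (ciSup_le_iff (bddAbove_range_restrict hcm (zeroSet (κ y)))).symm
    simp only [sub_nonpos, Subtype.forall]
    rfl
  exact NullMeasurable.aemeasurable key

section Moments

variable [Nonempty X] (hm : Measurable ξ) (hY : Measurable Y)
  (hsq : Integrable (fun ω => ‖ξ ω‖ ^ 2) P)
  (hne : ∀ᵐ y ∂P.map Y, (zeroSet (condDistrib ξ Y P y)).Nonempty)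
include hm hY hsq

lemma obsMax_ae_eq : obsMax P ξ Y =ᵐ[P]
    fun ω => ⨆ u : zeroSet (condDistrib ξ Y P (Y ω)), meanFn (condDistrib ξ Y P (Y ω)) u := by
  have h := ae_of_ae_map (hY.prodMk hm).aemeasurable (ae_map_eq_meanFn_on_zeroSet hm hY hsq)
  filter_upwards [h] with ω hω
  exact iSup_congr fun u => hω u u.2

omit hm hY hsq [Nonempty X] in
lemma obsMax_le_pathMax {ω : Ω} (h : (zeroSet (condDistrib ξ Y P (Y ω))).Nonempty) :
    obsMax P ξ Y ω ≤ pathMax (ξ ω) :=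
  have := h.to_subtype
  ciSup_le fun _ => le_pathMax _ _

omit hm hY hsq [Nonempty X] in
lemma le_obsMax {ω : Ω} {u : X} (h : u ∈ zeroSet (condDistrib ξ Y P (Y ω))) :
    ξ ω u ≤ obsMax P ξ Y ω :=
  le_ciSup (bddAbove_range_restrict (ξ ω).continuous _)
    (⟨u, h⟩ : zeroSet (condDistrib ξ Y P (Y ω)))

omit hm hY hsq [Nonempty X] in
lemma obsMax_mono {ω : Ω} (h : (zeroSet (condDistrib ξ Y P (Y ω))).Nonempty)
    (hsub : zeroSet (condDistrib ξ Y P (Y ω)) ⊆ zeroSet (condDistrib ξ Y' P (Y' ω))) :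
    obsMax P ξ Y ω ≤ obsMax P ξ Y' ω :=
  have := h.to_subtype
  ciSup_le fun u => le_obsMax (hsub u.2)

omit hm hY hsq in
lemma abs_obsMax_le {ω : Ω} (h : (zeroSet (condDistrib ξ Y P (Y ω))).Nonempty) :
    |obsMax P ξ Y ω| ≤ ‖ξ ω‖ := by
  obtain ⟨u, hu⟩ := h
  refine abs_le.2 ⟨?_, ?_⟩
  · exact (abs_le.1 ((ξ ω).norm_coe_le_norm u)).1.trans (le_obsMax hu)
  · exact (obsMax_le_pathMax ⟨u, hu⟩).trans (le_of_abs_le (abs_pathMax_le _))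

omit hm hY [Nonempty X] in
lemma integrable_norm_path (hm : Measurable ξ) : Integrable (fun ω => ‖ξ ω‖) P :=
  ((memLp_two_iff_integrable_sq hm.norm.aestronglyMeasurable).2 hsq).integrable (by norm_num)

omit hY in
lemma integrable_pathMax_path : Integrable (fun ω => pathMax (ξ ω)) P :=
  (integrable_norm_path hsq hm).mono'
    (continuous_pathMax.measurable.comp hm).aestronglyMeasurable
    (ae_of_all _ fun _ => abs_pathMax_le _)

lemma integral_pathMax_ae_eq_condExp :
    P[fun ω => pathMax (ξ ω) | MeasurableSpace.comap Y inferInstance] =ᵐ[P]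
      fun ω => ∫ f, pathMax f ∂condDistrib ξ Y P (Y ω) :=
  condExp_ae_eq_integral_condDistrib hY hm.aemeasurable continuous_pathMax.stronglyMeasurable
    (integrable_pathMax_path hm hsq)

lemma integrable_integral_pathMax :
    Integrable (fun ω => ∫ f, pathMax f ∂condDistrib ξ Y P (Y ω)) P :=
  integrable_condExp.congr (integral_pathMax_ae_eq_condExp hm hY hsq)

lemma integral_integral_pathMax :
    ∫ ω, ∫ f, pathMax f ∂condDistrib ξ Y P (Y ω) ∂P = ∫ ω, pathMax (ξ ω) ∂P := by
  rw [← integral_congr_ae (integral_pathMax_ae_eq_condExp hm hY hsq),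
    integral_condExp hY.comap_le]

include hne

lemma aestronglyMeasurable_obsMax :
    AEStronglyMeasurable[MeasurableSpace.comap Y inferInstance] (obsMax P ξ Y) P :=
  ((aemeasurable_iSup_meanFn hm hY hsq hne).aestronglyMeasurable.comp_ae_measurable'
    hY.aemeasurable).congr (obsMax_ae_eq hm hY hsq).symm

lemma integrable_obsMax : Integrable (obsMax P ξ Y) P := by
  refine (integrable_norm_path hsq hm).mono'
    ((aestronglyMeasurable_obsMax hm hY hsq hne).mono hY.comap_le) ?_
  filter_upwards [ae_of_ae_map hY.aemeasurable hne] with ω hω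
  exact abs_obsMax_le hω

lemma functionalH_condDistrib_ae_eq :
    ∀ᵐ ω ∂P, functionalH (condDistrib ξ Y P (Y ω)) =
      ((∫ f, pathMax f ∂condDistrib ξ Y P (Y ω) - obsMax P ξ Y ω : ℝ) : EReal) := by
  filter_upwards [obsMax_ae_eq hm hY hsq, ae_of_ae_map hY.aemeasurable hne,
    ae_of_ae_map hY.aemeasurable (ae_integrable_norm_sq hm hY hsq)] with ω h1 h2 h3
  rw [h1, functionalH_eq_coe h3 h2]

/-- The maximum of the conditional mean exceeds the known maximum by at most `H`: known values are
values of the conditional mean, and no value of the mean exceeds the mean of the maximum. -/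
lemma obsMax_le_iSup_meanFn_le :
    ∀ᵐ ω ∂P, obsMax P ξ Y ω ≤ ⨆ x, meanFn (condDistrib ξ Y P (Y ω)) x ∧
      ⨆ x, meanFn (condDistrib ξ Y P (Y ω)) x ≤ ∫ f, pathMax f ∂condDistrib ξ Y P (Y ω) := by
  filter_upwards [obsMax_ae_eq hm hY hsq, ae_of_ae_map hY.aemeasurable hne,
    ae_of_ae_map hY.aemeasurable (ae_integrable_norm_sq hm hY hsq)] with ω h1 h2 h3
  have hn := integrable_norm_of_sq h3
  have := h2.to_subtype
  refine ⟨h1.trans_le (ciSup_le fun u => ?_), ciSup_le fun x => meanFn_le_integral_pathMax hn x⟩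
  exact le_ciSup (isCompact_range (continuous_meanFn hn)).bddAbove (u : X)

lemma aemeasurable_functionalH :
    AEMeasurable (fun y => (functionalH (condDistrib ξ Y P y)).toENNReal) (P.map Y) := by
  have h1 : Measurable fun y => ∫ f, pathMax f ∂condDistrib ξ Y P y :=
    (StronglyMeasurable.integral_kernel continuous_pathMax.stronglyMeasurable).measurable
  have h2 := aemeasurable_iSup_meanFn hm hY hsq hne
  refine (h1.aemeasurable.sub h2).ennreal_ofReal.congr ?_
  filter_upwards [hne, ae_integrable_norm_sq hm hY hsq] with y h2 h3
  rw [functionalH_eq_coe h3 h2]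
  rfl

/-- The expected residual uncertainty is the gap between the expected maximum of the path and the
expected known maximum. -/
lemma lintegral_functionalH :
    ∫⁻ ω, (functionalH (condDistrib ξ Y P (Y ω))).toENNReal ∂P =
      ENNReal.ofReal (∫ ω, pathMax (ξ ω) ∂P - ∫ ω, obsMax P ξ Y ω ∂P) := by
  have hi1 := integrable_integral_pathMax hm hY hsq
  have hi2 := integrable_obsMax hm hY hsq hne
  rw [← integral_integral_pathMax hm hY hsq, ← integral_sub hi1 hi2,
    ofReal_integral_eq_lintegral_ofReal (hi1.sub' hi2)]
  · refine lintegral_congr_ae ?_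
    filter_upwards [functionalH_condDistrib_ae_eq hm hY hsq hne] with ω hω
    rw [hω]
    rfl
  · filter_upwards [obsMax_le_iSup_meanFn_le hm hY hsq hne] with ω hω
    exact sub_nonneg.2 (hω.1.trans hω.2)

omit hne in
lemma aestronglyMeasurable_iSup_meanFn :
    AEStronglyMeasurable (fun ω => ⨆ x, meanFn (condDistrib ξ Y P (Y ω)) x) P := by
  have h : Measurable fun y => ⨆ i, meanFn (condDistrib ξ Y P y) (TopologicalSpace.denseSeq X i) :=
    Measurable.iSup fun i => measurable_meanFn _ _
  refine (h.comp hY).aestronglyMeasurable.congr ?_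
  filter_upwards [ae_of_ae_map hY.aemeasurable (ae_integrable_norm_sq hm hY hsq)] with ω hω
  exact (iSup_eq_iSup_denseSeq (continuous_meanFn (integrable_norm_of_sq hω))).symm

end Moments

end Observation

/-! ### One more observation -/

section IteratedConditioning

variable {X : Type*} [MetricSpace X] [CompactSpace X]
variable {Ω : Type*} [MeasurableSpace Ω] {P : Measure Ω} [IsProbabilityMeasure P]
variable {ξ : Ω → C(X, ℝ)} {A A' : Type*} [MeasurableSpace A] [MeasurableSpace A']
variable {Y : Ω → A} {Y' : Ω → A'}

lemma lintegral_lintegral_condDistrib (hm : Measurable ξ) (hY : Measurable Y)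
    {φ : A × C(X, ℝ) → ℝ≥0∞} (hφ : Measurable φ) :
    ∫⁻ y, ∫⁻ f, φ (y, f) ∂condDistrib ξ Y P y ∂P.map Y = ∫⁻ ω, φ (Y ω, ξ ω) ∂P := by
  rw [← Measure.lintegral_compProd hφ, compProd_map_condDistrib hm.aemeasurable,
    lintegral_map hφ (hY.prodMk hm)]

variable [MeasurableSpace X] [BorelSpace X] {d : A → X} {g : A × ℝ → A'} {h : A' → A × ℝ}

lemma measurable_eval_comp (hd : Measurable d) : Measurable fun z : A × C(X, ℝ) => z.2 (d z.1) := by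
  have hc : Measurable fun q : C(X, ℝ) × X => q.1 q.2 := continuous_eval.measurable
  exact hc.comp (measurable_snd.prodMk (hd.comp measurable_fst))

variable (hm : Measurable ξ) (hY : Measurable Y) (hd : Measurable d) (hg : Measurable g)
  (hh : Measurable h) (hhg : ∀ a, h (g a) = a) (hY' : ∀ ω, Y' ω = g (Y ω, ξ ω (d (Y ω))))
include hm hY hd hg hh hhg hY'

/-- Conditioning on `Y` and then on the value at the point `d(Y)` amounts to conditioning on the
enlarged observation `Y' = g(Y, ξ(d(Y)))`, where the encoding `g` has the left inverse `h`. Both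
describe the same joint law of `Y`, `ξ(d(Y))` and `ξ`, and disintegrations are unique. -/
lemma cond_condDistrib_ae_eq :
    ∀ᵐ y ∂P.map Y, ∀ᵐ f ∂condDistrib ξ Y P y,
      cond (condDistrib ξ Y P y) (d y) (f (d y)) = condDistrib ξ Y' P (g (y, f (d y))) := by
  set κ := condDistrib ξ Y P with hκ
  set κ' := condDistrib ξ Y' P with hκ'
  have hev := measurable_eval_comp (X := X) hd
  have hY'm : Measurable Y' := by
    rw [show Y' = fun ω => g (Y ω, ξ ω (d (Y ω))) from funext hY']
    exact hg.comp (hY.prodMk (hev.comp (hY.prodMk hm)))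
  set T : A × C(X, ℝ) → ℝ × C(X, ℝ) := fun z => (z.2 (d z.1), z.2) with hT
  have hTm : Measurable T := hev.prodMk measurable_snd
  -- the two ways of drawing first the value at `d y`, then the whole path
  set K₁ : Kernel A (ℝ × C(X, ℝ)) := (Kernel.id ×ₖ κ).map T with hK₁
  set η : Kernel (A × ℝ) C(X, ℝ) := κ'.comap g hg with hη
  have : IsMarkovKernel K₁ := Kernel.IsMarkovKernel.map _ hTm
  have hK₁app : ∀ y, K₁ y = (κ y).map fun f => (f (d y), f) := by
    intro y
    rw [hK₁, Kernel.map_apply _ hTm, Kernel.prod_apply, Kernel.id_apply, Measure.dirac_prod,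
      Measure.map_map hTm measurable_prodMk_left]
    rfl
  have hevy : ∀ y, Measurable fun f : C(X, ℝ) => f (d y) := fun y =>
    (continuous_eval_const (F := C(X, ℝ)) (d y)).measurable
  have hpair : ∀ y, Measurable fun f : C(X, ℝ) => (f (d y), f) := fun y =>
    (hevy y).prodMk measurable_id
  have hfst : ∀ y, K₁.fst y = (κ y).map fun f => f (d y) := by
    intro y
    rw [Kernel.fst_apply, hK₁app, Measure.map_map measurable_fst (hpair y)]
    rfl
  have hkey : P.map Y ⊗ₘ K₁ = P.map Y ⊗ₘ (K₁.fst ⊗ₖ η) := by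
    refine Measure.ext_of_lintegral _ fun φ hφ => ?_
    rw [Measure.lintegral_compProd hφ, Measure.lintegral_compProd hφ]
    have hφ₁ : Measurable fun z : A × C(X, ℝ) => φ (z.1, T z) := by fun_prop
    have hφ₂ : Measurable fun z : A' × C(X, ℝ) => φ ((h z.1).1, (h z.1).2, z.2) := by fun_prop
    set Ψ : A' → ℝ≥0∞ := fun y' => ∫⁻ f, φ ((h y').1, (h y').2, f) ∂κ' y' with hΨ
    have hΨm : Measurable Ψ := Measurable.lintegral_kernel_prod_right hφ₂
    have hφ₃ : Measurable fun z : A × C(X, ℝ) => Ψ (g (z.1, z.2 (d z.1))) := by fun_prop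
    have e1 : ∀ y, ∫⁻ q, φ (y, q) ∂K₁ y = ∫⁻ f, φ (y, T (y, f)) ∂κ y := by
      intro y
      rw [hK₁app, lintegral_map (by fun_prop) (hpair y)]
    have e2 : ∀ y, ∫⁻ q, φ (y, q) ∂(K₁.fst ⊗ₖ η) y = ∫⁻ f, Ψ (g (y, f (d y))) ∂κ y := by
      intro y
      have hz : Measurable fun z : ℝ => ∫⁻ f, φ (y, z, f) ∂η (y, z) := by
        have h1 : Measurable fun z : A × ℝ => ∫⁻ f, φ (z.1, z.2, f) ∂η z :=
          Measurable.lintegral_kernel_prod_right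
            (f := fun (z : A × ℝ) (f : C(X, ℝ)) => φ (z.1, z.2, f)) (by
              unfold Function.uncurry; fun_prop)
        exact h1.comp measurable_prodMk_left
      rw [Kernel.lintegral_compProd _ _ _ (by fun_prop), hfst, lintegral_map hz (hevy y)]
      refine lintegral_congr fun f => ?_
      rw [hΨ, hη, Kernel.comap_apply]
      simp only [hhg]
    simp_rw [e1, e2]
    rw [lintegral_lintegral_condDistrib hm hY hφ₁, lintegral_lintegral_condDistrib hm hY hφ₃]
    have e3 : ∫⁻ ω, Ψ (g (Y ω, ξ ω (d (Y ω)))) ∂P = ∫⁻ ω, Ψ (Y' ω) ∂P :=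
      lintegral_congr fun ω => by rw [hY']
    rw [e3, ← lintegral_map hΨm hY'm, hΨ, lintegral_lintegral_condDistrib hm hY'm hφ₂]
    refine lintegral_congr fun ω => ?_
    rw [hY', hhg]
  filter_upwards [Kernel.ae_eq_of_compProd_eq hkey] with y hy
  rw [hK₁app, Kernel.compProd_apply_eq_compProd_sectR, hfst] at hy
  have hc : condDistrib (fun f : C(X, ℝ) => f) (fun f : C(X, ℝ) => f (d y)) (κ y)
      =ᵐ[(κ y).map fun f => f (d y)] Kernel.sectR η y :=
    condDistrib_ae_eq_of_measure_eq_compProd _ measurable_id.aemeasurable hy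
  filter_upwards [ae_of_ae_map (hevy y).aemeasurable hc] with f hf
  rw [cond, hf, Kernel.sectR_apply, hη, Kernel.comap_apply]

/-- The expectation of `J` at the next observation point is the expected residual uncertainty
after that observation. -/
lemma lintegral_functionalJ [Nonempty X] (hsq : Integrable (fun ω => ‖ξ ω‖ ^ 2) P)
    (hne : ∀ᵐ y ∂P.map Y', (zeroSet (condDistrib ξ Y' P y)).Nonempty) :
    ∫⁻ ω, functionalJ (condDistrib ξ Y P (Y ω)) (d (Y ω)) ∂P =
      ∫⁻ ω, (functionalH (condDistrib ξ Y' P (Y' ω))).toENNReal ∂P := by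
  have hev := measurable_eval_comp (X := X) hd
  have hgm : Measurable fun z : A × C(X, ℝ) => g (z.1, z.2 (d z.1)) := by fun_prop
  have hY'm : Measurable Y' := by
    rw [show Y' = fun ω => g (Y ω, ξ ω (d (Y ω))) from funext hY']
    exact hgm.comp (hY.prodMk hm)
  -- `H` of the conditional distribution, up to a null set, as a measurable function of `Y'`
  obtain ⟨Hm, hHmm, hHae⟩ := aemeasurable_functionalH hm hY'm hsq hne
  have hmap : P.map Y' = (P.map fun ω => (Y ω, ξ ω)).map fun z => g (z.1, z.2 (d z.1)) := by
    rw [Measure.map_map hgm (hY.prodMk hm)]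
    congr 1
    funext ω
    exact hY' ω
  have hae : ∀ᵐ y ∂P.map Y, ∀ᵐ f ∂condDistrib ξ Y P y,
      (functionalH (condDistrib ξ Y' P (g (y, f (d y))))).toENNReal = Hm (g (y, f (d y))) := by
    have h1 := hHae
    rw [Filter.EventuallyEq, hmap] at h1
    exact ae_ae_condDistrib hm (ae_of_ae_map hgm.aemeasurable h1)
  have hJ : ∀ᵐ ω ∂P, functionalJ (condDistrib ξ Y P (Y ω)) (d (Y ω)) =
      ∫⁻ f, Hm (g (Y ω, f (d (Y ω)))) ∂condDistrib ξ Y P (Y ω) := by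
    filter_upwards [ae_of_ae_map hY.aemeasurable hae, ae_of_ae_map hY.aemeasurable
      (cond_condDistrib_ae_eq hm hY hd hg hh hhg hY')] with ω h1 h2
    refine lintegral_congr_ae ?_
    filter_upwards [h1, h2] with f h3 h4
    rw [h4, h3]
  rw [lintegral_congr_ae hJ, ← lintegral_map (f := fun y => ∫⁻ f, Hm (g (y, f (d y)))
    ∂condDistrib ξ Y P y) (Measurable.lintegral_kernel_prod_right (hHmm.comp hgm)) hY,
    lintegral_lintegral_condDistrib hm hY (φ := fun z => Hm (g (z.1, z.2 (d z.1))))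
      (hHmm.comp hgm)]
  refine lintegral_congr_ae ?_
  filter_upwards [ae_of_ae_map hY'm.aemeasurable hHae] with ω hω
  rw [hω, hY']

end IteratedConditioning

/-! ### Sequential designs -/

section Snoc

variable {X : Type*} [MeasurableSpace X]

lemma measurable_snoc {n : ℕ} {A : Type*} [MeasurableSpace A]
    {u : A → Fin n → X × ℝ} {v : A → X × ℝ} (hu : Measurable u) (hv : Measurable v) :
    Measurable fun a => (Fin.snoc (u a) (v a) : Fin (n + 1) → X × ℝ) := by
  refine measurable_pi_lambda _ fun i => ?_
  refine Fin.lastCases ?_ (fun j => ?_) i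
  · simpa using hv
  · simpa using measurable_pi_iff.1 hu j

lemma measurable_init {n : ℕ} :
    Measurable fun y : Fin (n + 1) → X × ℝ => (Fin.init y : Fin n → X × ℝ) :=
  measurable_pi_lambda _ fun i => measurable_pi_apply i.castSucc

end Snoc

section SequentialDesign

variable {X : Type*} [MetricSpace X] [CompactSpace X] [MeasurableSpace X] [BorelSpace X]
variable {Ω : Type*} [MeasurableSpace Ω] {ξ : Ω → C(X, ℝ)} {D : ℕ → Ω → X}

omit [CompactSpace X] [MeasurableSpace X] [BorelSpace X] [MeasurableSpace Ω] in
lemma obs_succ (n : ℕ) (ω : Ω) :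
    obs ξ D (n + 1) ω = Fin.snoc (obs ξ D n ω) (D n ω, ξ ω (D n ω)) := by
  funext i
  refine Fin.lastCases ?_ (fun j => ?_) i
  · simp [obs]
  · simp [obs]

omit [CompactSpace X] [MeasurableSpace X] [BorelSpace X] [MeasurableSpace Ω] in
lemma init_obs_succ (n : ℕ) (ω : Ω) : Fin.init (obs ξ D (n + 1) ω) = obs ξ D n ω := rfl

lemma measurable_obs (hm : Measurable ξ) (hD : IsSequentialDesign ξ D) (n : ℕ) :
    Measurable (obs ξ D n) := by
  induction n with
  | zero => exact measurable_pi_lambda _ fun i => i.elim0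
  | succ n ih =>
    have hDn : Measurable (D n) := (hD n).mono ih.comap_le le_rfl
    have hc : Measurable fun q : C(X, ℝ) × X => q.1 q.2 := continuous_eval.measurable
    rw [show obs ξ D (n + 1) = _ from funext (obs_succ n)]
    exact measurable_snoc ih (hDn.prodMk (hc.comp (hm.prodMk hDn)))

omit [CompactSpace X] [BorelSpace X] [MeasurableSpace Ω] in
lemma obsSigma_mono : Monotone fun n => obsSigma ξ D n := by
  refine monotone_nat_of_le_succ fun n => ?_
  have h : obs ξ D n = (fun y : Fin (n + 1) → X × ℝ => Fin.init y) ∘ obs ξ D (n + 1) := rfl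
  change MeasurableSpace.comap (obs ξ D n) _ ≤ _
  rw [h, ← MeasurableSpace.comap_comp]
  exact MeasurableSpace.comap_mono measurable_init.comap_le

variable {P : Measure Ω} [IsProbabilityMeasure P]

lemma ae_nonempty_zeroSet_obs (hm : Measurable ξ) (hD : IsSequentialDesign ξ D)
    (hsq : Integrable (fun ω => ‖ξ ω‖ ^ 2) P) (n : ℕ) :
    ∀ᵐ y ∂P.map (obs ξ D (n + 1)),
      (zeroSet (condDistrib ξ (obs ξ D (n + 1)) P y)).Nonempty := by
  filter_upwards [ae_mem_zeroSet hm (measurable_obs hm hD (n + 1)) hsq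
    (h := fun y => y 0) (measurable_pi_apply 0) (fun ω => rfl)] with y hy using ⟨_, hy⟩

omit [MeasurableSpace X] [BorelSpace X] in
lemma integrable_eval_path (hm : Measurable ξ) (hsq : Integrable (fun ω => ‖ξ ω‖ ^ 2) P) (x : X) :
    Integrable (fun ω => ξ ω x) P :=
  (integrable_norm_path hsq hm).mono'
    ((continuous_eval_const (F := C(X, ℝ)) x).measurable.comp hm).aestronglyMeasurable
    (ae_of_all _ fun ω => (ξ ω).norm_coe_le_norm x)

/-- The comparison of expectations on which the convergence rests: up to `ε`, the next
observation of a quasi-SUR design is at least as good, on average, as an observation at any fixed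
point `x`. -/
lemma integral_max_le_add [Nonempty X] (hm : Measurable ξ) (hD : IsSequentialDesign ξ D)
    (hsq : Integrable (fun ω => ‖ξ ω‖ ^ 2) P) {n : ℕ}
    (hne : ∀ᵐ y ∂P.map (obs ξ D n),
      (zeroSet (condDistrib ξ (obs ξ D n) P y)).Nonempty) {ε : ℝ} (hε : 0 ≤ ε)
    (hsur : ∀ᵐ ω ∂P, functionalJ (post P ξ D n ω) (D n ω) ≤
      (⨅ x, functionalJ (post P ξ D n ω) x) + ENNReal.ofReal ε) (x : X) :
    ∫ ω, max (knownMax P ξ D n ω) (ξ ω x) ∂P ≤ ∫ ω, knownMax P ξ D (n + 1) ω ∂P + ε := by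
  have hY := measurable_obs hm hD n
  have hY₁ := measurable_obs hm hD (n + 1)
  obtain ⟨d, hd, hDd⟩ := (hD n).exists_eq_measurable_comp
  have hDd' : ∀ ω, D n ω = d (obs ξ D n ω) := fun ω => congrFun hDd ω
  -- the design that observes at `x` instead of `D n`
  set Y₂ : Ω → Fin (n + 1) → X × ℝ := fun ω => Fin.snoc (obs ξ D n ω) (x, ξ ω x) with hY₂def
  have hξx : Measurable fun ω => ξ ω x :=
    (continuous_eval_const (F := C(X, ℝ)) x).measurable.comp hm
  have hY₂ : Measurable Y₂ := measurable_snoc hY (measurable_const.prodMk hξx)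
  have hmem : ∀ᵐ y ∂P.map Y₂, (y (Fin.last n)).1 ∈ zeroSet (condDistrib ξ Y₂ P y) :=
    ae_mem_zeroSet hm hY₂ hsq (h := fun y => y (Fin.last n)) (measurable_pi_apply _)
      (fun ω => by simp [hY₂def])
  have hne₁ := ae_nonempty_zeroSet_obs hm hD hsq n
  have hne₂ : ∀ᵐ y ∂P.map Y₂, (zeroSet (condDistrib ξ Y₂ P y)).Nonempty :=
    hmem.mono fun y hy => ⟨_, hy⟩
  -- `snoc` encodes the new value; dropping the last design point recovers observation and value
  have hh : Measurable fun y : Fin (n + 1) → X × ℝ =>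
      ((Fin.init y : Fin n → X × ℝ), (y (Fin.last n)).2) :=
    measurable_init.prodMk (measurable_pi_apply _).snd
  have hg : ∀ {e : (Fin n → X × ℝ) → X}, Measurable e →
      Measurable fun a : (Fin n → X × ℝ) × ℝ =>
        (Fin.snoc a.1 (e a.1, a.2) : Fin (n + 1) → X × ℝ) := fun he =>
    measurable_snoc measurable_fst ((he.comp measurable_fst).prodMk measurable_snd)
  have hJ₁ := lintegral_functionalJ hm hY hd (hg hd) hh (fun a => by simp)
    (Y' := obs ξ D (n + 1)) (fun ω => by simp [obs_succ, hDd']) hsq hne₁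
  have hJ₂ := lintegral_functionalJ hm hY (d := fun _ => x) measurable_const
    (hg measurable_const) hh (fun a => by simp) (Y' := Y₂) (fun ω => rfl) hsq hne₂
  rw [lintegral_functionalH hm hY₁ hsq hne₁] at hJ₁
  rw [lintegral_functionalH hm hY₂ hsq hne₂] at hJ₂
  have hi₂ := integrable_obsMax hm hY₂ hsq hne₂
  have hmax := integrable_pathMax_path hm hsq
  have hle₂ : ∫ ω, obsMax P ξ Y₂ ω ∂P ≤ ∫ ω, pathMax (ξ ω) ∂P := by
    refine integral_mono_ae hi₂ hmax ?_
    filter_upwards [ae_of_ae_map hY₂.aemeasurable hne₂] with ω hω using obsMax_le_pathMax hω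
  have hcomp : ENNReal.ofReal (∫ ω, pathMax (ξ ω) ∂P - ∫ ω, obsMax P ξ (obs ξ D (n + 1)) ω ∂P) ≤
      ENNReal.ofReal (∫ ω, pathMax (ξ ω) ∂P - ∫ ω, obsMax P ξ Y₂ ω ∂P + ε) := by
    rw [ENNReal.ofReal_add (sub_nonneg.2 hle₂) hε, ← hJ₁, ← hJ₂]
    calc ∫⁻ ω, functionalJ (condDistrib ξ (obs ξ D n) P (obs ξ D n ω)) (d (obs ξ D n ω)) ∂P
        ≤ ∫⁻ ω, (functionalJ (condDistrib ξ (obs ξ D n) P (obs ξ D n ω)) x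
            + ENNReal.ofReal ε) ∂P := by
          refine lintegral_mono_ae ?_
          filter_upwards [hsur] with ω hω
          rw [← hDd']
          exact hω.trans (add_le_add_left (iInf_le _ x) _)
      _ = _ := by
          rw [lintegral_add_right _ measurable_const]
          simp
  -- the expected maximum of the path cancels
  rw [ENNReal.ofReal_le_ofReal_iff (by linarith)] at hcomp
  have hle : ∀ᵐ ω ∂P, max (knownMax P ξ D n ω) (ξ ω x) ≤ obsMax P ξ Y₂ ω := by
    filter_upwards [ae_of_ae_map hY.aemeasurable hne, ae_of_ae_map hY₂.aemeasurable hmem,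
      ae_zeroSet_subset (Y := obs ξ D n) hm hY₂ hsq measurable_init
        (fun ω => by simp [hY₂def])] with ω h1 h2 h3
    refine max_le (obsMax_mono h1 h3) ?_
    have h4 : (Y₂ ω (Fin.last n)).1 = x := by simp [hY₂def]
    rw [h4] at h2
    exact le_obsMax h2
  have hmono : ∫ ω, max (knownMax P ξ D n ω) (ξ ω x) ∂P ≤ ∫ ω, obsMax P ξ Y₂ ω ∂P :=
    integral_mono_ae ((integrable_obsMax hm hY hsq hne).sup (integrable_eval_path hm hsq x)) hi₂ hle
  have : ∫ ω, knownMax P ξ D (n + 1) ω ∂P = ∫ ω, obsMax P ξ (obs ξ D (n + 1)) ω ∂P := rfl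
  linarith

/-! ### Convergence -/

/-- The indices start from `1`: before the first observation the zero set may be empty, and
`knownMax` is then the junk value `0`. -/
lemma ae_knownMax_mono [Nonempty X] (hm : Measurable ξ) (hD : IsSequentialDesign ξ D)
    (hsq : Integrable (fun ω => ‖ξ ω‖ ^ 2) P) :
    ∀ᵐ ω ∂P, Monotone fun n => knownMax P ξ D (n + 1) ω := by
  have h : ∀ᵐ ω ∂P, ∀ n, knownMax P ξ D (n + 1) ω ≤ knownMax P ξ D (n + 2) ω := by
    refine ae_all_iff.2 fun n => ?_
    have hY := measurable_obs hm hD (n + 1)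
    filter_upwards [ae_of_ae_map hY.aemeasurable (ae_nonempty_zeroSet_obs hm hD hsq n),
      ae_zeroSet_subset (Y := obs ξ D (n + 1)) hm (measurable_obs hm hD (n + 2)) hsq
        measurable_init (fun ω => (init_obs_succ (n + 1) ω).symm)] with ω h1 h2
    exact obsMax_mono h1 h2
  filter_upwards [h] with ω hω using monotone_nat_of_le_succ hω

/-- The known maximum converges to the maximum of the path: its limit `L` satisfies
`E max(L, ξ(x)) ≤ E L` for all `x`. -/
lemma ae_tendsto_knownMax [Nonempty X] (hm : Measurable ξ)
    (hsq : Integrable (fun ω => ‖ξ ω‖ ^ 2) P) (hD : IsQuasiSUR P ξ D) :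
    ∀ᵐ ω ∂P, Tendsto (fun n => knownMax P ξ D n ω) atTop (𝓝 (pathMax (ξ ω))) := by
  obtain ⟨hseq, ε, hε, hε0, n₀, hsur⟩ := hD
  have hY := fun n => measurable_obs hm hseq n
  have hne := ae_nonempty_zeroSet_obs (P := P) hm hseq hsq
  have hne' : ∀ᵐ ω ∂P, ∀ n, (zeroSet (post P ξ D (n + 1) ω)).Nonempty :=
    ae_all_iff.2 fun n => ae_of_ae_map (hY (n + 1)).aemeasurable (hne n)
  set N : ℕ → Ω → ℝ := fun n ω => knownMax P ξ D (n + 1) ω with hN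
  have hNint : ∀ n, Integrable (N n) P := fun n => integrable_obsMax hm (hY (n + 1)) hsq (hne n)
  set L : Ω → ℝ := fun ω => ⨆ n, N n ω with hL
  have hNle : ∀ᵐ ω ∂P, ∀ n, N n ω ≤ pathMax (ξ ω) :=
    hne'.mono fun ω h n => obsMax_le_pathMax (h n)
  have hNabs : ∀ᵐ ω ∂P, ∀ n, |N n ω| ≤ ‖ξ ω‖ := hne'.mono fun ω h n => abs_obsMax_le (h n)
  have hNL : ∀ᵐ ω ∂P, Tendsto (fun n => N n ω) atTop (𝓝 (L ω)) := by
    filter_upwards [ae_knownMax_mono hm hseq hsq, hNle] with ω h1 h2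
    exact tendsto_atTop_ciSup h1 ⟨pathMax (ξ ω), by rintro _ ⟨n, rfl⟩; exact h2 n⟩
  have hnorm := integrable_norm_path hsq hm
  have hLint : Integrable L P := by
    refine hnorm.mono' (aestronglyMeasurable_of_tendsto_ae atTop (fun n => (hNint n).1) hNL) ?_
    filter_upwards [hNL, hNabs] with ω h1 h2
    exact le_of_tendsto' h1.abs h2
  have hEN : Tendsto (fun n => ∫ ω, N n ω ∂P) atTop (𝓝 (∫ ω, L ω ∂P)) :=
    tendsto_integral_of_dominated_convergence _ (fun n => (hNint n).1) hnorm
      (fun n => hNabs.mono fun ω h => h n) hNL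
  have hx : ∀ x, ∀ᵐ ω ∂P, ξ ω x ≤ L ω := by
    intro x
    have hξx := integrable_eval_path hm hsq x
    have hEmax : Tendsto (fun n => ∫ ω, max (N n ω) (ξ ω x) ∂P) atTop
        (𝓝 (∫ ω, max (L ω) (ξ ω x) ∂P)) := by
      refine tendsto_integral_of_dominated_convergence (fun ω => ‖ξ ω‖)
        (fun n => ((hNint n).sup hξx).1) hnorm (fun n => ?_) ?_
      · filter_upwards [hNabs] with ω h
        exact abs_max_le_max_abs_abs.trans (max_le (h n) ((ξ ω).norm_coe_le_norm x))
      · filter_upwards [hNL] with ω h using h.max tendsto_const_nhds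
    have hlim : ∫ ω, max (L ω) (ξ ω x) ∂P ≤ ∫ ω, L ω ∂P + 0 := by
      refine le_of_tendsto_of_tendsto hEmax (((tendsto_add_atTop_iff_nat 1).2 hEN).add
        ((tendsto_add_atTop_iff_nat 1).2 hε0)) ?_
      filter_upwards [eventually_ge_atTop n₀] with n hn
      exact integral_max_le_add hm hseq hsq (hne n) (hε (n + 1)).le (hsur (n + 1) (by omega)) x
    have heq := (integral_eq_iff_of_ae_le hLint (hLint.sup hξx)
      (ae_of_all _ fun ω => le_max_left _ _)).1
      (le_antisymm (integral_mono hLint (hLint.sup hξx) fun ω => le_max_left _ _)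
        (by simpa using hlim))
    filter_upwards [heq] with ω hω
    rw [hω]
    exact le_max_right _ _
  have hdense : ∀ᵐ ω ∂P, ∀ i, ξ ω (TopologicalSpace.denseSeq X i) ≤ L ω :=
    ae_all_iff.2 fun i => hx _
  filter_upwards [hdense, hNL, hNle] with ω h1 h2 h3
  have heq : L ω = pathMax (ξ ω) := by
    refine le_antisymm (le_of_tendsto' h2 h3) ?_
    rw [pathMax, iSup_eq_iSup_denseSeq (ξ ω).continuous]
    exact ciSup_le h1
  rw [heq] at h2
  exact (tendsto_add_atTop_iff_nat 1).1 h2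

/-- The conditional expectations of the maximum converge to the maximum itself: their limit
dominates it and has the same expectation. -/
lemma ae_tendsto_integral_pathMax [Nonempty X] (hm : Measurable ξ)
    (hsq : Integrable (fun ω => ‖ξ ω‖ ^ 2) P) (hD : IsQuasiSUR P ξ D) :
    ∀ᵐ ω ∂P, Tendsto (fun n => ∫ f, pathMax f ∂post P ξ D n ω) atTop (𝓝 (pathMax (ξ ω))) := by
  have hY := fun n => measurable_obs hm hD.1 n
  have hne := ae_nonempty_zeroSet_obs (P := P) hm hD.1 hsq
  let ℱ : Filtration ℕ ‹MeasurableSpace Ω› :=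
    { seq := fun n => obsSigma ξ D n
      mono' := obsSigma_mono
      le' := fun n => (hY n).comap_le }
  set G : Ω → ℝ := P[fun ω => pathMax (ξ ω) | ⨆ n, ℱ n] with hG
  have hmax := integrable_pathMax_path hm hsq
  have hlim : ∀ᵐ ω ∂P, Tendsto (fun n => ∫ f, pathMax f ∂post P ξ D n ω) atTop (𝓝 (G ω)) := by
    have h1 := tendsto_ae_condExp (μ := P) (ℱ := ℱ) fun ω => pathMax (ξ ω)
    have h2 : ∀ᵐ ω ∂P, ∀ n, (P[fun ω => pathMax (ξ ω) | ℱ n]) ω =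
        ∫ f, pathMax f ∂post P ξ D n ω :=
      ae_all_iff.2 fun n => integral_pathMax_ae_eq_condExp hm (hY n) hsq
    filter_upwards [h1, h2] with ω h3 h4
    exact h3.congr h4
  have hle : (fun ω => pathMax (ξ ω)) ≤ᵐ[P] G := by
    have h1 : ∀ᵐ ω ∂P, ∀ n, knownMax P ξ D (n + 1) ω ≤ ∫ f, pathMax f ∂post P ξ D (n + 1) ω :=
      ae_all_iff.2 fun n => (obsMax_le_iSup_meanFn_le hm (hY (n + 1)) hsq (hne n)).mono
        fun ω h => h.1.trans h.2
    filter_upwards [h1, hlim, ae_tendsto_knownMax hm hsq hD] with ω h2 h3 h4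
    exact le_of_tendsto_of_tendsto' ((tendsto_add_atTop_iff_nat 1).2 h4)
      ((tendsto_add_atTop_iff_nat 1).2 h3) h2
  have hint : ∫ ω, pathMax (ξ ω) ∂P = ∫ ω, G ω ∂P :=
    (integral_condExp (iSup_le fun n => ℱ.le n)).symm
  have heq := (integral_eq_iff_of_ae_le hmax integrable_condExp hle).1 hint
  filter_upwards [heq, hlim] with ω h1 h2
  rw [h1]
  exact h2

lemma tendsto_integral_sub_knownMax [Nonempty X] (hm : Measurable ξ)
    (hsq : Integrable (fun ω => ‖ξ ω‖ ^ 2) P) (hD : IsQuasiSUR P ξ D) :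
    Tendsto (fun n => ∫ ω, pathMax (ξ ω) ∂P - ∫ ω, knownMax P ξ D n ω ∂P) atTop (𝓝 0) := by
  have hY := fun n => measurable_obs hm hD.1 n
  have hne := ae_nonempty_zeroSet_obs (P := P) hm hD.1 hsq
  have h : Tendsto (fun n => ∫ ω, knownMax P ξ D (n + 1) ω ∂P) atTop
      (𝓝 (∫ ω, pathMax (ξ ω) ∂P)) := by
    refine tendsto_integral_of_dominated_convergence (fun ω => ‖ξ ω‖)
      (fun n => (integrable_obsMax hm (hY (n + 1)) hsq (hne n)).1) (integrable_norm_path hsq hm)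
      (fun n => ?_) ?_
    · filter_upwards [ae_of_ae_map (hY (n + 1)).aemeasurable (hne n)] with ω h
      exact abs_obsMax_le h
    · filter_upwards [ae_tendsto_knownMax hm hsq hD] with ω h
      exact (tendsto_add_atTop_iff_nat 1).2 h
  have h' := (tendsto_add_atTop_iff_nat (f := fun n => ∫ ω, knownMax P ξ D n ω ∂P) 1).1 h
  simpa using h'.const_sub (∫ ω, pathMax (ξ ω) ∂P)

end SequentialDesign

lemma tendstoInL1_of_abs_sub_le {Ω : Type*} [MeasurableSpace Ω] {P : Measure Ω}
    {Y : ℕ → Ω → ℝ} {Z : Ω → ℝ} {B : ℕ → Ω → ℝ} (hY : ∀ n ≥ 1, AEStronglyMeasurable (Y n) P)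
    (hZ : Integrable Z P) (hB : ∀ n ≥ 1, Integrable (B n) P)
    (hle : ∀ n ≥ 1, ∀ᵐ ω ∂P, |Y n ω - Z ω| ≤ B n ω)
    (hlim : Tendsto (fun n => ∫ ω, B n ω ∂P) atTop (𝓝 0)) : TendstoInL1 P Y Z := by
  have hint : ∀ n ≥ 1, Integrable (fun ω => Y n ω - Z ω) P := fun n hn =>
    (hB n hn).mono' ((hY n hn).sub hZ.1) (hle n hn)
  refine ⟨fun n hn => by simpa [Pi.add_def] using (hint n hn).add hZ, hZ, ?_⟩
  refine squeeze_zero' (Eventually.of_forall fun n => integral_nonneg fun ω => abs_nonneg _) ?_ hlim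
  filter_upwards [eventually_ge_atTop 1] with n hn
  exact integral_mono_ae (hint n hn).abs (hB n hn) (hle n hn)

end ExpectedImprovement

open ExpectedImprovement in
theorem mainTheorem11 {X : Type*} [MetricSpace X] [CompactSpace X] [MeasurableSpace X]
    [BorelSpace X] {Ω : Type*} [MeasurableSpace Ω] (P : Measure Ω) [IsProbabilityMeasure P]
    (ξ : Ω → C(X, ℝ)) (hξ_meas : ∀ x, Measurable fun ω => ξ ω x)
    (hξ : IsGaussianProcess (fun (x : X) (ω : Ω) => ξ ω x) P)
    (D : ℕ → Ω → X) (hD : IsQuasiSUR P ξ D) :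
    (∀ n ≥ 1, ∀ᵐ ω ∂P, (zeroSet (post P ξ D n ω)).Nonempty) ∧
    (∀ᵐ ω ∂P,
      Tendsto (fun n => maxMean P ξ D n ω - knownMax P ξ D n ω) atTop (𝓝 0) ∧
      Tendsto (fun n => residual P ξ D n ω) atTop (𝓝 0) ∧
      Tendsto (fun n => knownMax P ξ D n ω) atTop (𝓝 (pathMax (ξ ω)))) ∧
    TendstoInL1 P (fun n ω => maxMean P ξ D n ω - knownMax P ξ D n ω) (fun _ => 0) ∧
    TendstoInL1 P (fun n ω => (residual P ξ D n ω).toReal) (fun _ => 0) ∧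
    TendstoInL1 P (fun n ω => knownMax P ξ D n ω) (fun ω => pathMax (ξ ω)) := by
  obtain ⟨ω₀⟩ := nonempty_of_isProbabilityMeasure P
  have : Nonempty X := ⟨D 0 ω₀⟩
  have hm := measurable_of_measurable_eval hξ_meas
  have hsq := integrable_norm_sq hm hξ
  have hY := fun n => measurable_obs hm hD.1 n
  have hne : ∀ n ≥ 1, ∀ᵐ y ∂P.map (obs ξ D n),
      (zeroSet (condDistrib ξ (obs ξ D n) P y)).Nonempty := by
    rintro (_ | n) hn
    · omega
    · exact ae_nonempty_zeroSet_obs hm hD.1 hsq n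
  have hmax := integrable_pathMax_path hm hsq
  have hM : ∀ n ≥ 1, Integrable (fun ω => knownMax P ξ D n ω) P := fun n hn =>
    integrable_obsMax hm (hY n) hsq (hne n hn)
  have hE : ∀ n, Integrable (fun ω => ∫ f, pathMax f ∂post P ξ D n ω) P := fun n =>
    integrable_integral_pathMax hm (hY n) hsq
  have hHeq : ∀ n ≥ 1, ∀ᵐ ω ∂P, residual P ξ D n ω =
      ((∫ f, pathMax f ∂post P ξ D n ω - knownMax P ξ D n ω : ℝ) : EReal) := fun n hn =>
    functionalH_condDistrib_ae_eq hm (hY n) hsq (hne n hn)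
  have hmean : ∀ n ≥ 1, ∀ᵐ ω ∂P, knownMax P ξ D n ω ≤ maxMean P ξ D n ω ∧
      maxMean P ξ D n ω ≤ ∫ f, pathMax f ∂post P ξ D n ω := fun n hn =>
    obsMax_le_iSup_meanFn_le hm (hY n) hsq (hne n hn)
  have hmeanm : ∀ n, AEStronglyMeasurable (fun ω => maxMean P ξ D n ω) P := fun n =>
    aestronglyMeasurable_iSup_meanFn hm (hY n) hsq
  have hgap := tendsto_integral_sub_knownMax hm hsq hD
  have hgap' : Tendsto (fun n => ∫ ω, (∫ f, pathMax f ∂post P ξ D n ω - knownMax P ξ D n ω) ∂P)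
      atTop (𝓝 0) := by
    refine hgap.congr' ?_
    filter_upwards [eventually_ge_atTop 1] with n hn
    rw [integral_sub (hE n) (hM n hn)]
    congr 1
    exact (integral_integral_pathMax hm (hY n) hsq).symm
  refine ⟨fun n hn => ae_of_ae_map (hY n).aemeasurable (hne n hn), ?_, ?_, ?_, ?_⟩
  · have h1 : ∀ᵐ ω ∂P, ∀ n ≥ 1, residual P ξ D n ω =
        ((∫ f, pathMax f ∂post P ξ D n ω - knownMax P ξ D n ω : ℝ) : EReal) :=
      ae_all_iff.2 fun n => (em (n ≥ 1)).elim (fun hn => (hHeq n hn).mono fun ω h _ => h)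
        (fun hn => ae_of_all _ fun ω h => absurd h hn)
    have h2 : ∀ᵐ ω ∂P, ∀ n ≥ 1, knownMax P ξ D n ω ≤ maxMean P ξ D n ω ∧
        maxMean P ξ D n ω ≤ ∫ f, pathMax f ∂post P ξ D n ω :=
      ae_all_iff.2 fun n => (em (n ≥ 1)).elim (fun hn => (hmean n hn).mono fun ω h _ => h)
        (fun hn => ae_of_all _ fun ω h => absurd h hn)
    filter_upwards [h1, h2, ae_tendsto_knownMax hm hsq hD,
      ae_tendsto_integral_pathMax hm hsq hD] with ω h3 h4 h5 h6
    have h7 : Tendsto (fun n => ∫ f, pathMax f ∂post P ξ D n ω - knownMax P ξ D n ω) atTop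
        (𝓝 0) := by simpa using h6.sub h5
    refine ⟨?_, ?_, h5⟩
    · refine squeeze_zero' ?_ ?_ h7
      · filter_upwards [eventually_ge_atTop 1] with n hn using sub_nonneg.2 (h4 n hn).1
      · filter_upwards [eventually_ge_atTop 1] with n hn using sub_le_sub_right (h4 n hn).2 _
    · refine ((continuous_coe_real_ereal.tendsto 0).comp h7).congr' ?_
      filter_upwards [eventually_ge_atTop 1] with n hn using (h3 n hn).symm
  · refine tendstoInL1_of_abs_sub_le (fun n hn => (hmeanm n).sub (hM n hn).1)
      (integrable_zero _ _ _) (fun n hn => (hE n).sub (hM n hn)) (fun n hn => ?_) hgap'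
    filter_upwards [hmean n hn] with ω h
    rw [sub_zero, abs_of_nonneg (sub_nonneg.2 h.1)]
    exact sub_le_sub_right h.2 _
  · have htoReal : ∀ n ≥ 1, (fun ω => ∫ f, pathMax f ∂post P ξ D n ω - knownMax P ξ D n ω)
        =ᵐ[P] fun ω => (residual P ξ D n ω).toReal := fun n hn =>
      (hHeq n hn).mono fun ω h => by simp only [h, EReal.toReal_coe]
    refine tendstoInL1_of_abs_sub_le (fun n hn => ((hE n).sub (hM n hn)).1.congr (htoReal n hn))
      (integrable_zero _ _ _) (fun n hn => (hE n).sub (hM n hn)) (fun n hn => ?_) hgap'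
    filter_upwards [htoReal n hn, hmean n hn] with ω h1 h2
    rw [sub_zero, ← h1, abs_of_nonneg (sub_nonneg.2 (h2.1.trans h2.2))]
    rfl
  · refine tendstoInL1_of_abs_sub_le (B := fun n ω => pathMax (ξ ω) - knownMax P ξ D n ω)
      (fun n hn => (hM n hn).1) hmax (fun n hn => hmax.sub (hM n hn)) (fun n hn => ?_) ?_
    · filter_upwards [ae_of_ae_map (hY n).aemeasurable (hne n hn)] with ω h
      have hle : knownMax P ξ D n ω ≤ pathMax (ξ ω) := obsMax_le_pathMax h
      rw [abs_sub_comm, abs_of_nonneg (sub_nonneg.2 hle)]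
    · refine hgap.congr' ?_
      filter_upwards [eventually_ge_atTop 1] with n hn
      rw [integral_sub hmax (hM n hn)]
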